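/- Let $n,m$ be coprime integers with $0<m<n$, $n$ odd and $2n+m$ divisible by $6$. Let $b\ge 1$ be the real number with $\frac{1+\sqrt{1+8b^3}}{4b^3}=\frac mn$ (equivalently $2b^3=\frac{n(n+m)}{m^2}$), let $r>0$ with $r^2=\frac{n(n+2m)}{2b^2m^2}$, and let $p\in[0,1)$ with $p^2=\frac{n^2-m^2}{n(n+2m)}$. Put $$K=\int_0^{\pi/2}\frac{d\theta}{\sqrt{1-p^2\sin^2\theta}},\qquad E=\int_0^{\pi/2}\sqrt{1-p^2\sin^2\theta}\,d\theta,$$ and let $\mathrm{sn},\mathrm{cn},\mathrm{dn}$ be the Jacobi elliptic functions of modulus $p$. Let $G_{n,m}$ be the group of transformations of $\mathbb R^2$ generated by $$(x,y)\mapsto (x+4K/r,\,y),\qquad (x,y)\mapsto(-x,\,y+\sqrt2\,mb\pi/3),$$ and let $K_{n,m}=\mathbb R^2/G_{n,m}$ be the Klein bottle with the Riemannian metric induced by the minimal Lagrangian immersion $\Phi_{n,m}:K_{n,m}\to\mathbb{CP}^2$, $$(x,y)\mapsto\left[\left(\sqrt{\tfrac{n}{2n+m}}\,\mathrm{dn}(rx)e^{\frac{i(n+m)y}{\sqrt2mb}},\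 \sqrt{\tfrac{n+m}{2n+m}}\,\mathrm{cn}(rx)e^{\frac{-iny}{\sqrt2mb}},\ \sqrt{\tfrac{n+m}{n+2m}}\,\mathrm{sn}(rx)e^{\frac{-iy}{\sqrt2b}}\right)\right],$$ where $\mathbb{CP}^2$ carries the Fubini--Study metric of constant holomorphic sectional curvature $4$. Then: 1. The first positive eigenvalue $\lambda_1$ of the Laplacian on functions of $K_{n,m}$ (the least $\lambda>0$ such that $\Delta f+\lambda f=0$ for some nonzero smooth $f:K_{n,m}\to\mathbb R$, where $\Delta$ is the Laplace--Beltrami operator) exists and satisfies $$\lambda_1<2-\frac1{2b^3}=2-\frac{m^2}{n(n+m)}.$$ 2. The area of $K_{n,m}$ is $$\frac{4\pi\sqrt n}{3\sqrt{n+2m}}\,\bigl((n+2m)E-mK\bigr).$$ -/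

import Mathlib

open scoped ContDiff

noncomputable section

namespace KleinCP2

/-! ### Elliptic integrals and Jacobi elliptic functions of modulus `p` -/

/-- Incomplete elliptic integral of the first kind. -/
def ellipticF (p φ : ℝ) : ℝ := ∫ θ in (0 : ℝ)..φ, 1 / √(1 - p ^ 2 * Real.sin θ ^ 2)

/-- Complete elliptic integral of the first kind. -/
def ellipticK (p : ℝ) : ℝ := ∫ θ in (0 : ℝ)..(Real.pi / 2), 1 / √(1 - p ^ 2 * Real.sin θ ^ 2)

/-- Complete elliptic integral of the second kind. -/
def ellipticE (p : ℝ) : ℝ := ∫ θ in (0 : ℝ)..(Real.pi / 2), √(1 - p ^ 2 * Real.sin θ ^ 2)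

/-- Jacobi amplitude: the inverse function of `φ ↦ ellipticF p φ`, which is a bijection of `ℝ`
for `0 ≤ p < 1` (see `ellipticF_bijective`). -/
def jacobiAm (p : ℝ) : ℝ → ℝ := Function.invFun (ellipticF p)

def jacobiSn (p x : ℝ) : ℝ := Real.sin (jacobiAm p x)

def jacobiCn (p x : ℝ) : ℝ := Real.cos (jacobiAm p x)

def jacobiDn (p x : ℝ) : ℝ := √(1 - p ^ 2 * jacobiSn p x ^ 2)

/-! ### Surfaces given by a metric on the plane and a group of transformations -/

/-- The coordinate vector fields `∂/∂x`, `∂/∂y` of the plane. -/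
def coordVec : Fin 2 → ℝ × ℝ := ![(1, 0), (0, 1)]

/-- Partial derivative of a function on the plane. -/
def pderiv {F : Type*} [NormedAddCommGroup F] [NormedSpace ℝ F]
    (i : Fin 2) (f : ℝ × ℝ → F) (q : ℝ × ℝ) : F :=
  fderiv ℝ f q (coordVec i)

/-- Horizontal part, for the Hopf projection from the unit sphere of `ℂ³` to the complex
projective plane, of a vector `v` at a point `z` of the sphere. -/
def hopfHorizontal (z v : EuclideanSpace ℂ (Fin 3)) : EuclideanSpace ℂ (Fin 3) :=
  v - (inner ℂ z v) • z

/-- The metric induced on the plane by `[ψ]`, where `ψ` takes values in the unit sphere of `ℂ³` and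
the complex projective plane carries the Fubini-Study metric of constant holomorphic
sectional curvature `4`, that is, the metric for which the Hopf projection from the unit sphere is a
Riemannian submersion. -/
def inducedMetric (ψ : ℝ × ℝ → EuclideanSpace ℂ (Fin 3)) (q : ℝ × ℝ) : Matrix (Fin 2) (Fin 2) ℝ :=
  Matrix.of fun i j =>
    (inner ℂ (hopfHorizontal (ψ q) (pderiv i ψ q)) (hopfHorizontal (ψ q) (pderiv j ψ q))).re

/-- Area density `√(det g)` of a metric on the plane. -/
def areaDensity (g : ℝ × ℝ → Matrix (Fin 2) (Fin 2) ℝ) (q : ℝ × ℝ) : ℝ := √((g q).det)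

/-- Riemannian area measure of a metric on the plane. -/
def areaMeasure (g : ℝ × ℝ → Matrix (Fin 2) (Fin 2) ℝ) : MeasureTheory.Measure (ℝ × ℝ) :=
  MeasureTheory.volume.withDensity fun q => ENNReal.ofReal (areaDensity g q)

/-- Laplace-Beltrami operator `(det g)^(-1/2) ∑ ∂_i ((det g)^(1/2) g^{ij} ∂_j f)` of a metric on
the plane (sign convention: `∂_x² + ∂_y²` for the flat metric). -/
def laplaceBeltrami (g : ℝ × ℝ → Matrix (Fin 2) (Fin 2) ℝ) (f : ℝ × ℝ → ℝ) (q : ℝ × ℝ) : ℝ :=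
  (areaDensity g q)⁻¹ *
    ∑ i, pderiv i (fun q' => areaDensity g q' * ∑ j, (g q')⁻¹ i j * pderiv j f q') q

/-- The quotient of the plane by a group of transformations. -/
def PlaneQuotient (G : Subgroup (Equiv.Perm (ℝ × ℝ))) : Type :=
  MulAction.orbitRel.Quotient G (ℝ × ℝ)

/-- The projection of the plane onto its quotient. -/
def PlaneQuotient.proj (G : Subgroup (Equiv.Perm (ℝ × ℝ))) (q : ℝ × ℝ) : PlaneQuotient G :=
  Quotient.mk (MulAction.orbitRel G (ℝ × ℝ)) q

/-- The positive eigenvalues of the Laplacian on smooth real functions on the quotient of the plane,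
with a metric `g`, by a group `G` acting by isometries of `g`, freely and properly
discontinuously: `lam > 0` with `Δ f + lam f = 0` for some smooth `f ≠ 0` on the quotient.
As the projection is a local isometry, smoothness and the Laplacian are read in the plane. -/
def positiveEigenvalues (G : Subgroup (Equiv.Perm (ℝ × ℝ)))
    (g : ℝ × ℝ → Matrix (Fin 2) (Fin 2) ℝ) : Set ℝ :=
  {lam | 0 < lam ∧ ∃ f : PlaneQuotient G → ℝ,
    f ≠ 0 ∧ ContDiff ℝ ∞ (f ∘ PlaneQuotient.proj G) ∧
      ∀ q, laplaceBeltrami g (f ∘ PlaneQuotient.proj G) q + lam * f (PlaneQuotient.proj G q) = 0}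

/-- Area of the quotient of the plane, with metric `g`, by a discrete group `G` of isometries:
the area of a fundamental domain. -/
def quotientArea (G : Subgroup (Equiv.Perm (ℝ × ℝ)))
    (g : ℝ × ℝ → Matrix (Fin 2) (Fin 2) ℝ) : ENNReal :=
  MeasureTheory.covolume G (ℝ × ℝ) (areaMeasure g)

/-! ### The minimal Lagrangian Klein bottles `K_{n,m}` -/

/-- The parameter `b ≥ 1` with `(1 + √(1 + 8 b³)) / (4 b³) = m / n` (see `paramB_spec`). -/
def paramB (n m : ℤ) : ℝ := ((n : ℝ) * (n + m) / (2 * m ^ 2)) ^ (1 / 3 : ℝ)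

/-- The parameter `r > 0` with `r² = n (n + 2 m) / (2 b² m²)`. -/
def paramR (n m : ℤ) : ℝ := √((n : ℝ) * (n + 2 * m) / (2 * paramB n m ^ 2 * m ^ 2))

/-- The modulus `p ≥ 0` with `p² = (n² - m²) / (n (n + 2 m))`. -/
def modulus (n m : ℤ) : ℝ := √(((n : ℝ) ^ 2 - m ^ 2) / (n * (n + 2 * m)))

/-- The translation `(x, y) ↦ (x + a, y)`. -/
def translationX (a : ℝ) : Equiv.Perm (ℝ × ℝ) where
  toFun q := (q.1 + a, q.2)
  invFun q := (q.1 - a, q.2)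
  left_inv q := by simp
  right_inv q := by simp

/-- The glide reflection `(x, y) ↦ (-x, y + c)`. -/
def glideReflection (c : ℝ) : Equiv.Perm (ℝ × ℝ) where
  toFun q := (-q.1, q.2 + c)
  invFun q := (-q.1, q.2 - c)
  left_inv q := by simp
  right_inv q := by simp

/-- The group generated by `(x, y) ↦ (x + 4K/r, y)` and `(x, y) ↦ (-x, y + √2 m b π / 3)`. -/
def kleinGroup (n m : ℤ) : Subgroup (Equiv.Perm (ℝ × ℝ)) :=
  Subgroup.closure
    {translationX (4 * ellipticK (modulus n m) / paramR n m),
      glideReflection (√2 * m * paramB n m * Real.pi / 3)}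

/-- The unit-sphere lift of the immersion: `(x, y)` is sent to
`(λ dn(rx) e^{i(n+m)y/(√2 m b)}, μ cn(rx) e^{-iny/(√2 m b)}, ν sn(rx) e^{-iy/(√2 b)})`, with
`λ² = n/(2n+m)`, `μ² = (n+m)/(2n+m)`, `ν² = (n+m)/(n+2m)`. -/
def immersionLift (n m : ℤ) (q : ℝ × ℝ) : EuclideanSpace ℂ (Fin 3) :=
  let b := paramB n m
  let p := modulus n m
  let t := paramR n m * q.1
  !₂[((√((n : ℝ) / (2 * n + m)) * jacobiDn p t : ℝ) : ℂ) *
        Complex.exp (Complex.I * (((n + m) * q.2 / (√2 * m * b) : ℝ) : ℂ)),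
    ((√(((n : ℝ) + m) / (2 * n + m)) * jacobiCn p t : ℝ) : ℂ) *
        Complex.exp (-Complex.I * ((n * q.2 / (√2 * m * b) : ℝ) : ℂ)),
    ((√(((n : ℝ) + m) / (n + 2 * m)) * jacobiSn p t : ℝ) : ℂ) *
        Complex.exp (-Complex.I * ((q.2 / (√2 * b) : ℝ) : ℂ))]

/-- The metric induced on the plane, hence on the Klein bottle, by the immersion. -/
def kleinMetric (n m : ℤ) : ℝ × ℝ → Matrix (Fin 2) (Fin 2) ℝ := inducedMetric (immersionLift n m)

/-- The positive Laplace eigenvalues of `K_{n,m}`. -/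
def kleinPositiveEigenvalues (n m : ℤ) : Set ℝ :=
  positiveEigenvalues (kleinGroup n m) (kleinMetric n m)

/-- The area of `K_{n,m}`. -/
def kleinArea (n m : ℤ) : ENNReal := quotientArea (kleinGroup n m) (kleinMetric n m)

/-! ### Well-definedness of the amplitude and of `b` -/

theorem ellipticF_bijective {p : ℝ} (hp0 : 0 ≤ p) (hp1 : p < 1) :
    Function.Bijective (ellipticF p) := by
  have hpos : ∀ θ : ℝ, 0 < 1 - p ^ 2 * Real.sin θ ^ 2 := fun θ => by
    nlinarith [Real.sin_sq_le_one θ, sq_nonneg (Real.sin θ), sq_nonneg p]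
  have hcont : Continuous fun θ : ℝ => 1 / √(1 - p ^ 2 * Real.sin θ ^ 2) :=
    continuous_const.div (by fun_prop) fun θ => (Real.sqrt_pos.2 (hpos θ)).ne'
  have hge : ∀ θ : ℝ, 1 ≤ 1 / √(1 - p ^ 2 * Real.sin θ ^ 2) := fun θ => by
    rw [le_div_iff₀ (Real.sqrt_pos.2 (hpos θ)), one_mul]
    exact Real.sqrt_le_one.2 (by nlinarith [mul_nonneg (sq_nonneg p) (sq_nonneg (Real.sin θ))])
  have hd : ∀ φ, HasDerivAt (ellipticF p) (1 / √(1 - p ^ 2 * Real.sin φ ^ 2)) φ := fun φ =>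
    intervalIntegral.integral_hasDerivAt_right (hcont.intervalIntegrable _ _)
      (hcont.stronglyMeasurableAtFilter _ _) hcont.continuousAt
  have hF : Continuous (ellipticF p) :=
    continuous_iff_continuousAt.2 fun φ => (hd φ).continuousAt
  have h0 : ellipticF p 0 = 0 := by simp [ellipticF]
  have hmono : Monotone fun φ => ellipticF p φ - φ :=
    monotone_of_hasDerivAt_nonneg (fun φ => (hd φ).sub (hasDerivAt_id φ))
      fun φ => sub_nonneg.2 (hge φ)
  refine ⟨StrictMono.injective fun x y hxy => ?_, hF.surjective ?_ ?_⟩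
  · have := hmono hxy.le
    simp only at this
    linarith
  · refine Filter.tendsto_atTop_mono' _ ?_ Filter.tendsto_id
    filter_upwards [Filter.eventually_ge_atTop 0] with x hx
    have := hmono hx
    simp only [h0] at this
    simp only [id]
    linarith
  · refine Filter.tendsto_atBot_mono' _ ?_ Filter.tendsto_id
    filter_upwards [Filter.eventually_le_atBot 0] with x hx
    have := hmono hx
    simp only [h0] at this
    simp only [id]
    linarith

theorem paramB_spec {n m : ℤ} (hm : 0 < m) (hmn : m < n) (x : ℝ) :
    (1 ≤ x ∧ (1 + √(1 + 8 * x ^ 3)) / (4 * x ^ 3) = m / n) ↔ x = paramB n m := by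
  have hm' : (0 : ℝ) < m := by exact_mod_cast hm
  have hmn' : (m : ℝ) < n := by exact_mod_cast hmn
  have hn' : (0 : ℝ) < n := hm'.trans hmn'
  have hc : 0 ≤ (n : ℝ) * (n + m) / (2 * m ^ 2) := by positivity
  have hb3 : paramB n m ^ 3 = (n : ℝ) * (n + m) / (2 * m ^ 2) := by
    unfold paramB
    rw [← Real.rpow_natCast, ← Real.rpow_mul hc]
    norm_num
  have hb0 : 0 ≤ paramB n m := Real.rpow_nonneg hc _
  constructor
  · rintro ⟨hx, he⟩
    have hx3 : 0 < x ^ 3 := by positivity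
    rw [div_eq_div_iff (by positivity) hn'.ne'] at he
    have hs := Real.sq_sqrt (show 0 ≤ 1 + 8 * x ^ 3 by positivity)
    set s := √(1 + 8 * x ^ 3)
    have h1 : s * n = m * (4 * x ^ 3) - n := by linarith
    have h2 : (1 + 8 * x ^ 3) * n ^ 2 = (m * (4 * x ^ 3) - n) ^ 2 := by
      rw [← h1, ← hs]; ring
    have h3 : x ^ 3 * (8 * (n * (n + m) - 2 * m ^ 2 * x ^ 3)) = 0 := by linarith
    have h4 : (n : ℝ) * (n + m) - 2 * m ^ 2 * x ^ 3 = 0 := by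
      rcases mul_eq_zero.1 h3 with h | h <;> linarith
    refine (pow_left_inj₀ (by linarith) hb0 (by norm_num : (3 : ℕ) ≠ 0)).1 ?_
    rw [hb3, eq_div_iff (by positivity)]
    linarith
  · rintro rfl
    have h1 : (1 : ℝ) ≤ paramB n m :=
      Real.one_le_rpow (by rw [le_div_iff₀ (by positivity)]; nlinarith) (by norm_num)
    refine ⟨h1, ?_⟩
    rw [hb3, show 1 + 8 * ((n : ℝ) * (n + m) / (2 * m ^ 2)) = ((2 * n + m) / m) ^ 2 by
      field_simp; ring, Real.sqrt_sq (by positivity)]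
    field_simp
    ring

end KleinCP2

end

/-!
The lift `Φ` is a profile curve in `x` moved by a one-parameter group of diagonal unitary matrices
in `y`, so the induced metric is conformal, `ρ(x) (dx² + dy²)`, with
`ρ(x) = r² ((n + m) / (n + 2m) - p² sn²(rx)) = r² (dn²(rx) - m / (n + 2m))`.

*Area.* The rectangle `[0, 4K/r) × [0, √2 m b π / 3)` is a fundamental domain, `ρ` has the
symmetries of `sn²`, and `∫₀ᴷ dn² = E` by the substitution `θ = am x`.

*Eigenvalue bound.* An even `4K/r`-periodic solution `u` of `u'' + λ ρ u = 0` descends to an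
eigenfunction of the Klein bottle. Now `cn(rx)` solves `v'' + k v = 0` with
`k = r² (1 - 2 p² sn²(rx)) < σ ρ`, where `σ = 2 - m² / (n (n + m))`, and has its first zero at
`K/r`. By Sturm comparison the solution of `u'' + σ ρ u = 0` with `u(0) = 1`, `u'(0) = 0` vanishes
before `K/r`. Its Prüfer angle at `K/r` is continuous in `λ` and is `0` for `λ = 0`, so for some
`0 < λ < σ` the solution has its first zero exactly at `K/r`; the symmetry of `ρ` about `0` and
`K/r` makes it even and `2K/r`-antiperiodic.

*Existence of a least eigenvalue.* Eigenfunctions lift to a torus. Functions with zero integral over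
each cell of a fine grid satisfy `∫ ρ f² ≤ ε ∫ |∇f|²` by the Poincaré inequality. A span of more
eigenfunctions with eigenvalues at most `Λ` than there are cells contains such an `f ≠ 0`,
contradicting `∫ |∇f|² ≤ Λ ∫ ρ f²` as soon as `ε Λ < 1`. So only finitely many eigenvalues lie
below any bound.
-/

namespace KleinCP2

open MeasureTheory

/-! ### Jacobi elliptic functions -/

section Jacobi

variable {p : ℝ}

theorem one_sub_sq_mul_sin_sq_pos (hp : |p| < 1) (θ : ℝ) : 0 < 1 - p ^ 2 * Real.sin θ ^ 2 := by
  have hp2 : p ^ 2 < 1 := (sq_lt_one_iff_abs_lt_one p).2 hp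
  nlinarith [Real.sin_sq_le_one θ, sq_nonneg (Real.sin θ)]

theorem hasDerivAt_ellipticF (hp : |p| < 1) (φ : ℝ) :
    HasDerivAt (ellipticF p) (1 / √(1 - p ^ 2 * Real.sin φ ^ 2)) φ := by
  have hcont : Continuous fun θ : ℝ => 1 / √(1 - p ^ 2 * Real.sin θ ^ 2) :=
    continuous_const.div (by fun_prop) fun θ =>
      (Real.sqrt_pos.2 (one_sub_sq_mul_sin_sq_pos hp θ)).ne'
  exact intervalIntegral.integral_hasDerivAt_right (hcont.intervalIntegrable _ _)
    (hcont.stronglyMeasurableAtFilter _ _) hcont.continuousAt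

theorem ellipticF_zero (p : ℝ) : ellipticF p 0 = 0 := intervalIntegral.integral_same

theorem ellipticF_pi_div_two (p : ℝ) : ellipticF p (Real.pi / 2) = ellipticK p := rfl

theorem strictMono_ellipticF (hp : |p| < 1) : StrictMono (ellipticF p) :=
  strictMono_of_hasDerivAt_pos (hasDerivAt_ellipticF hp) fun φ =>
    div_pos one_pos (Real.sqrt_pos.2 (one_sub_sq_mul_sin_sq_pos hp φ))

theorem surjective_ellipticF (hp : |p| < 1) : Function.Surjective (ellipticF p) := by
  have habs : ellipticF |p| = ellipticF p := funext fun φ => by simp only [ellipticF, sq_abs]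
  exact habs ▸ (ellipticF_bijective (abs_nonneg p) hp).2

theorem ellipticK_pos (hp : |p| < 1) : 0 < ellipticK p := by
  simpa only [ellipticF_zero, ellipticF_pi_div_two]
    using strictMono_ellipticF hp (half_pos Real.pi_pos)

theorem ellipticF_const_sub (hp : |p| < 1) {c : ℝ}
    (hc : ∀ φ, Real.sin (c - φ) ^ 2 = Real.sin φ ^ 2) (φ : ℝ) :
    ellipticF p (c - φ) = 2 * ellipticF p (c / 2) - ellipticF p φ := by
  have hderiv (x : ℝ) : HasDerivAt (fun x => ellipticF p (c - x) + ellipticF p x) 0 x := by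
    refine (((hasDerivAt_ellipticF hp (c - x)).comp_const_sub c x).add
      (hasDerivAt_ellipticF hp x)).congr_deriv ?_
    rw [hc, neg_add_cancel]
  have hconst := is_const_of_deriv_eq_zero (fun x => (hderiv x).differentiableAt)
    (fun x => (hderiv x).deriv) φ (c / 2)
  simp only [sub_half] at hconst
  linarith

theorem ellipticF_neg (hp : |p| < 1) (φ : ℝ) : ellipticF p (-φ) = -ellipticF p φ := by
  simpa [ellipticF_zero] using ellipticF_const_sub hp (c := 0) (by simp) φ

theorem ellipticF_pi_sub (hp : |p| < 1) (φ : ℝ) :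
    ellipticF p (Real.pi - φ) = 2 * ellipticK p - ellipticF p φ :=
  ellipticF_const_sub hp (by simp) φ

theorem ellipticF_jacobiAm (hp : |p| < 1) (x : ℝ) : ellipticF p (jacobiAm p x) = x :=
  Function.rightInverse_invFun (surjective_ellipticF hp) x

theorem jacobiAm_ellipticF (hp : |p| < 1) (φ : ℝ) : jacobiAm p (ellipticF p φ) = φ :=
  Function.leftInverse_invFun (strictMono_ellipticF hp).injective φ

theorem jacobiAm_zero (hp : |p| < 1) : jacobiAm p 0 = 0 := by
  simpa only [ellipticF_zero] using jacobiAm_ellipticF hp 0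

theorem jacobiAm_ellipticK (hp : |p| < 1) : jacobiAm p (ellipticK p) = Real.pi / 2 :=
  jacobiAm_ellipticF hp (Real.pi / 2)

theorem jacobiAm_neg (hp : |p| < 1) (x : ℝ) : jacobiAm p (-x) = -jacobiAm p x := by
  apply (strictMono_ellipticF hp).injective
  rw [ellipticF_neg hp, ellipticF_jacobiAm hp, ellipticF_jacobiAm hp]

theorem jacobiAm_two_mul_sub (hp : |p| < 1) (x : ℝ) :
    jacobiAm p (2 * ellipticK p - x) = Real.pi - jacobiAm p x := by
  apply (strictMono_ellipticF hp).injective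
  rw [ellipticF_pi_sub hp, ellipticF_jacobiAm hp, ellipticF_jacobiAm hp]

theorem strictMono_jacobiAm (hp : |p| < 1) : StrictMono (jacobiAm p) := fun x y hxy => by
  rwa [← (strictMono_ellipticF hp).lt_iff_lt, ellipticF_jacobiAm hp, ellipticF_jacobiAm hp]

theorem continuous_jacobiAm (hp : |p| < 1) : Continuous (jacobiAm p) :=
  (strictMono_jacobiAm hp).monotone.continuous_of_surjective fun φ => ⟨_, jacobiAm_ellipticF hp φ⟩

theorem hasDerivAt_jacobiAm (hp : |p| < 1) (x : ℝ) :
    HasDerivAt (jacobiAm p) (jacobiDn p x) x := by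
  have hpos := Real.sqrt_pos.2 (one_sub_sq_mul_sin_sq_pos hp (jacobiAm p x))
  have hinv := (hasDerivAt_ellipticF hp (jacobiAm p x)).of_local_left_inverse
    (continuous_jacobiAm hp).continuousAt (by positivity)
    (Filter.Eventually.of_forall (ellipticF_jacobiAm hp))
  simpa [jacobiDn, jacobiSn] using hinv

theorem contDiff_jacobiAm (hp : |p| < 1) : ContDiff ℝ ∞ (jacobiAm p) := by
  have hderiv : deriv (jacobiAm p) = fun x => √(1 - p ^ 2 * Real.sin (jacobiAm p x) ^ 2) :=
    funext fun x => (hasDerivAt_jacobiAm hp x).deriv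
  refine contDiff_infty.2 fun k => ?_
  induction k with
  | zero => exact contDiff_zero.2 (continuous_jacobiAm hp)
  | succ k ih =>
    rw [Nat.cast_add_one, contDiff_succ_iff_deriv, hderiv]
    refine ⟨fun x => (hasDerivAt_jacobiAm hp x).differentiableAt, by simp, ?_⟩
    refine ContDiff.sqrt ?_ fun x => (one_sub_sq_mul_sin_sq_pos hp _).ne'
    exact contDiff_const.sub (contDiff_const.mul ((Real.contDiff_sin.comp ih).pow 2))

theorem contDiff_jacobiSn (hp : |p| < 1) : ContDiff ℝ ∞ (jacobiSn p) :=
  Real.contDiff_sin.comp (contDiff_jacobiAm hp)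

theorem jacobiDn_pos (hp : |p| < 1) (x : ℝ) : 0 < jacobiDn p x :=
  Real.sqrt_pos.2 (one_sub_sq_mul_sin_sq_pos hp _)

theorem jacobiDn_sq (hp : |p| < 1) (x : ℝ) : jacobiDn p x ^ 2 = 1 - p ^ 2 * jacobiSn p x ^ 2 :=
  Real.sq_sqrt (one_sub_sq_mul_sin_sq_pos hp _).le

theorem jacobiCn_sq (p x : ℝ) : jacobiCn p x ^ 2 = 1 - jacobiSn p x ^ 2 :=
  Real.cos_sq' _

theorem hasDerivAt_jacobiSn (hp : |p| < 1) (x : ℝ) :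
    HasDerivAt (jacobiSn p) (jacobiCn p x * jacobiDn p x) x :=
  (Real.hasDerivAt_sin _).comp x (hasDerivAt_jacobiAm hp x)

theorem hasDerivAt_jacobiCn (hp : |p| < 1) (x : ℝ) :
    HasDerivAt (jacobiCn p) (-jacobiSn p x * jacobiDn p x) x :=
  (Real.hasDerivAt_cos _).comp x (hasDerivAt_jacobiAm hp x)

theorem hasDerivAt_jacobiDn (hp : |p| < 1) (x : ℝ) :
    HasDerivAt (jacobiDn p) (-p ^ 2 * jacobiSn p x * jacobiCn p x) x := by
  have hsqrt := ((((hasDerivAt_jacobiSn hp x).fun_pow 2).const_mul (p ^ 2)).const_sub 1).sqrt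
    (one_sub_sq_mul_sin_sq_pos hp (jacobiAm p x)).ne'
  refine hsqrt.congr_deriv ?_
  have hpos := jacobiDn_pos hp x
  rw [← jacobiDn]
  field_simp
  ring

theorem jacobiSn_neg (hp : |p| < 1) (x : ℝ) : jacobiSn p (-x) = -jacobiSn p x := by
  simp only [jacobiSn, jacobiAm_neg hp, Real.sin_neg]

theorem jacobiSn_two_mul_sub (hp : |p| < 1) (x : ℝ) :
    jacobiSn p (2 * ellipticK p - x) = jacobiSn p x := by
  simp only [jacobiSn, jacobiAm_two_mul_sub hp, Real.sin_pi_sub]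

theorem jacobiCn_ellipticK (hp : |p| < 1) : jacobiCn p (ellipticK p) = 0 := by
  rw [jacobiCn, jacobiAm_ellipticK hp, Real.cos_pi_div_two]

theorem jacobiSn_zero (hp : |p| < 1) : jacobiSn p 0 = 0 := by
  rw [jacobiSn, jacobiAm_zero hp, Real.sin_zero]

theorem jacobiCn_pos_of_mem_Ico {x : ℝ} (hp : |p| < 1) (hx : x ∈ Set.Ico 0 (ellipticK p)) :
    0 < jacobiCn p x := by
  have hle : 0 ≤ jacobiAm p x := jacobiAm_zero hp ▸ (strictMono_jacobiAm hp).monotone hx.1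
  have hlt : jacobiAm p x < Real.pi / 2 := jacobiAm_ellipticK hp ▸ strictMono_jacobiAm hp hx.2
  exact Real.cos_pos_of_mem_Ioo ⟨by linarith [Real.pi_pos], hlt⟩

theorem integral_jacobiDn_sq (hp : |p| < 1) :
    ∫ x in (0 : ℝ)..ellipticK p, jacobiDn p x ^ 2 = ellipticE p := by
  have hsubst := intervalIntegral.integral_comp_mul_deriv (a := 0) (b := ellipticK p)
    (f := jacobiAm p) (f' := jacobiDn p) (g := fun θ => √(1 - p ^ 2 * Real.sin θ ^ 2))
    (fun x _ => hasDerivAt_jacobiAm hp x)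
    (fun x _ => (hasDerivAt_jacobiDn hp x).continuousAt.continuousWithinAt) (by fun_prop)
  rw [jacobiAm_zero hp, jacobiAm_ellipticK hp] at hsubst
  rw [ellipticE, ← hsubst]
  exact intervalIntegral.integral_congr fun x _ => sq _

end Jacobi

/-! ### The induced metric -/

section PlaneCalculus

variable {F : Type*} [NormedAddCommGroup F] [NormedSpace ℝ F] {f : ℝ × ℝ → F} {q : ℝ × ℝ}

theorem hasDerivAt_fst (hf : DifferentiableAt ℝ f q) :
    HasDerivAt (fun x => f (x, q.2)) (pderiv 0 f q) q.1 :=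
  HasFDerivAt.comp_hasDerivAt q.1 (f := fun x => (x, q.2)) hf.hasFDerivAt
    ((hasDerivAt_id q.1).prodMk (hasDerivAt_const q.1 q.2))

theorem hasDerivAt_snd (hf : DifferentiableAt ℝ f q) :
    HasDerivAt (fun y => f (q.1, y)) (pderiv 1 f q) q.2 :=
  HasFDerivAt.comp_hasDerivAt q.2 (f := fun y => (q.1, y)) hf.hasFDerivAt
    ((hasDerivAt_const q.2 q.1).prodMk (hasDerivAt_id q.2))

end PlaneCalculus

section PhaseSurface

variable {ι : Type*}

/-- The vector `u` with its `i`-th coordinate rotated by the angle `s i * y`. -/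
noncomputable def phaseVector (s : ι → ℝ) (y : ℝ) (u : ι → ℂ) : EuclideanSpace ℂ ι :=
  WithLp.toLp 2 fun i => u i * Complex.exp (Complex.I * (s i * y : ℝ))

/-- The surface swept by a real profile curve `A` under the one-parameter group of diagonal
unitary transformations with frequencies `s`. -/
noncomputable def phaseSurface (s : ι → ℝ) (A : ℝ → ι → ℝ) (q : ℝ × ℝ) : EuclideanSpace ℂ ι :=
  phaseVector s q.2 fun i => A q.1 i

theorem inner_phaseVector [Fintype ι] (s : ι → ℝ) (y : ℝ) (u v : ι → ℂ) :
    inner ℂ (phaseVector s y u) (phaseVector s y v) = ∑ i, v i * (starRingEnd ℂ) (u i) := by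
  simp only [PiLp.inner_apply, RCLike.inner_apply, phaseVector]
  refine Finset.sum_congr rfl fun i _ => ?_
  have hunit : Complex.exp (Complex.I * (s i * y : ℝ)) *
      (starRingEnd ℂ) (Complex.exp (Complex.I * (s i * y : ℝ))) = 1 := by
    rw [Complex.mul_conj, mul_comm Complex.I, Complex.normSq_eq_norm_sq,
      Complex.norm_exp_ofReal_mul_I, one_pow, Complex.ofReal_one]
  rw [map_mul, mul_mul_mul_comm, hunit, mul_one]

theorem hasDerivAt_cexp_I_mul (s y : ℝ) :
    HasDerivAt (fun y : ℝ => Complex.exp (Complex.I * (s * y : ℝ)))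
      (Complex.I * s * Complex.exp (Complex.I * (s * y : ℝ))) y := by
  refine ((((hasDerivAt_id y).const_mul s).ofReal_comp).const_mul Complex.I).cexp.congr_deriv ?_
  rw [mul_one, mul_comm, id]

variable {s : ι → ℝ} {A A' : ℝ → ι → ℝ}

theorem differentiable_phaseSurface [Finite ι]
    (hA : ∀ x i, HasDerivAt (fun x => A x i) (A' x i) x) :
    Differentiable ℝ (phaseSurface s A) := fun q => by
  cases nonempty_fintype ι
  refine (differentiableAt_piLp 2).2 fun i => ?_
  exact ((hA q.1 i).ofReal_comp.differentiableAt.comp q differentiableAt_fst).mul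
    ((hasDerivAt_cexp_I_mul (s i) q.2).differentiableAt.comp q differentiableAt_snd)

variable [Fintype ι]

theorem pderiv_zero_phaseSurface (hA : ∀ x i, HasDerivAt (fun x => A x i) (A' x i) x)
    (q : ℝ × ℝ) :
    pderiv 0 (phaseSurface s A) q = phaseVector s q.2 fun i => A' q.1 i := by
  have hcoord : HasDerivAt
      (fun x i => (A x i : ℂ) * Complex.exp (Complex.I * (s i * q.2 : ℝ))) _ q.1 :=
    hasDerivAt_pi.2 fun i => (hA q.1 i).ofReal_comp.mul_const _
  exact (hasDerivAt_fst (differentiable_phaseSurface hA q)).unique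
    ((PiLp.continuousLinearEquiv 2 ℝ fun _ : ι => ℂ).symm.hasFDerivAt.comp_hasDerivAt _ hcoord)

theorem pderiv_one_phaseSurface (hA : ∀ x i, HasDerivAt (fun x => A x i) (A' x i) x)
    (q : ℝ × ℝ) :
    pderiv 1 (phaseSurface s A) q = phaseVector s q.2 fun i => A q.1 i * (Complex.I * s i) := by
  have hcoord : HasDerivAt
      (fun y i => (A q.1 i : ℂ) * Complex.exp (Complex.I * (s i * y : ℝ))) _ q.2 :=
    hasDerivAt_pi.2 fun i => (hasDerivAt_cexp_I_mul (s i) q.2).const_mul _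
  simp only [phaseVector, mul_assoc] at hcoord ⊢
  exact (hasDerivAt_snd (differentiable_phaseSurface hA q)).unique
    ((PiLp.continuousLinearEquiv 2 ℝ fun _ : ι => ℂ).symm.hasFDerivAt.comp_hasDerivAt _ hcoord)

end PhaseSurface

theorem hopfHorizontal_of_inner_eq_zero {z v : EuclideanSpace ℂ (Fin 3)} (h : inner ℂ z v = 0) :
    hopfHorizontal z v = v := by
  rw [hopfHorizontal, h, zero_smul, sub_zero]

/-- The first condition says that the profile has constant norm, the second that the rotation
field is horizontal for the Hopf projection. -/
theorem inducedMetric_phaseSurface {s : Fin 3 → ℝ} {A A' : ℝ → Fin 3 → ℝ}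
    (hA : ∀ x i, HasDerivAt (fun x => A x i) (A' x i) x) {q : ℝ × ℝ}
    (hnorm : ∑ i, A q.1 i * A' q.1 i = 0) (hhor : ∑ i, s i * A q.1 i ^ 2 = 0) :
    inducedMetric (phaseSurface s A) q =
      Matrix.diagonal ![∑ i, A' q.1 i ^ 2, ∑ i, s i ^ 2 * A q.1 i ^ 2] := by
  have hinner0 : inner ℂ (phaseSurface s A q) (pderiv 0 (phaseSurface s A) q) = 0 := by
    rw [pderiv_zero_phaseSurface hA, phaseSurface, inner_phaseVector]
    simpa only [Complex.conj_ofReal, mul_comm] using mod_cast hnorm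
  have hinner1 : inner ℂ (phaseSurface s A q) (pderiv 1 (phaseSurface s A) q) = 0 := by
    rw [pderiv_one_phaseSurface hA, phaseSurface, inner_phaseVector]
    calc ∑ i, (A q.1 i * (Complex.I * s i)) * (starRingEnd ℂ) (A q.1 i : ℂ)
        = Complex.I * (∑ i, s i * A q.1 i ^ 2 : ℝ) := by
          rw [Complex.ofReal_sum, Finset.mul_sum]
          refine Finset.sum_congr rfl fun i _ => ?_
          rw [Complex.conj_ofReal]
          push_cast
          ring
      _ = 0 := by rw [hhor, Complex.ofReal_zero, mul_zero]
  have hhor0 := hopfHorizontal_of_inner_eq_zero hinner0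
  have hhor1 := hopfHorizontal_of_inner_eq_zero hinner1
  rw [pderiv_zero_phaseSurface hA] at hhor0
  rw [pderiv_one_phaseSurface hA] at hhor1
  ext i j
  fin_cases i <;> fin_cases j <;>
    simp only [inducedMetric, Matrix.of_apply, Fin.zero_eta, Fin.mk_one,
      pderiv_zero_phaseSurface hA, pderiv_one_phaseSurface hA, hhor0, hhor1, inner_phaseVector] <;>
    simp [Fin.sum_univ_three] <;> ring

section JacobiProfile

variable {c : Fin 3 → ℝ} {p : ℝ}

/-- The curve `(c₀ dn(rx), c₁ cn(rx), c₂ sn(rx))`; its norm is constant precisely when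
`c₂² = c₀² p² + c₁²`. -/
noncomputable def jacobiProfile (c : Fin 3 → ℝ) (p r x : ℝ) : Fin 3 → ℝ :=
  ![c 0 * jacobiDn p (r * x), c 1 * jacobiCn p (r * x), c 2 * jacobiSn p (r * x)]

/-- The derivative of `jacobiProfile c p r`. -/
noncomputable def jacobiProfileDeriv (c : Fin 3 → ℝ) (p r x : ℝ) : Fin 3 → ℝ :=
  ![c 0 * (r * (-p ^ 2 * jacobiSn p (r * x) * jacobiCn p (r * x))),
    c 1 * (r * (-jacobiSn p (r * x) * jacobiDn p (r * x))),
    c 2 * (r * (jacobiCn p (r * x) * jacobiDn p (r * x)))]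

theorem hasDerivAt_jacobiProfile (hp : |p| < 1) (c : Fin 3 → ℝ) (r x : ℝ) (i : Fin 3) :
    HasDerivAt (fun x => jacobiProfile c p r x i) (jacobiProfileDeriv c p r x i) x := by
  have hscale {g g' : ℝ → ℝ} (hg : ∀ t, HasDerivAt g (g' t) t) :
      HasDerivAt (fun x => g (r * x)) (r * g' (r * x)) x :=
    ((hg (r * x)).comp x ((hasDerivAt_id x).const_mul r)).congr_deriv
      (by rw [mul_one, mul_comm])
  fin_cases i
  · exact (hscale (hasDerivAt_jacobiDn hp)).const_mul (c 0)
  · exact (hscale (hasDerivAt_jacobiCn hp)).const_mul (c 1)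
  · exact (hscale (hasDerivAt_jacobiSn hp)).const_mul (c 2)

theorem sum_jacobiProfile_mul_deriv (hc : c 2 ^ 2 = c 0 ^ 2 * p ^ 2 + c 1 ^ 2) (r x : ℝ) :
    ∑ i, jacobiProfile c p r x i * jacobiProfileDeriv c p r x i = 0 := by
  simp only [jacobiProfile, jacobiProfileDeriv, Fin.sum_univ_three, Matrix.cons_val_zero,
    Matrix.cons_val_one, Matrix.cons_val]
  linear_combination (r * jacobiSn p (r * x) * jacobiCn p (r * x) * jacobiDn p (r * x)) * hc

theorem sum_jacobiProfileDeriv_sq (hp : |p| < 1) (hc : c 2 ^ 2 = c 0 ^ 2 * p ^ 2 + c 1 ^ 2)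
    (hc1 : c 0 ^ 2 + c 1 ^ 2 = 1) (r x : ℝ) :
    ∑ i, jacobiProfileDeriv c p r x i ^ 2 =
      r ^ 2 * (c 2 ^ 2 - p ^ 2 * jacobiSn p (r * x) ^ 2) := by
  simp only [jacobiProfileDeriv, Fin.sum_univ_three, Matrix.cons_val_zero, Matrix.cons_val_one,
    Matrix.cons_val, mul_pow, neg_sq, jacobiCn_sq, jacobiDn_sq hp]
  generalize jacobiSn p (r * x) = S
  linear_combination r ^ 2 * ((1 - S ^ 2) * (1 - p ^ 2 * S ^ 2) - 1) * hc -
    r ^ 2 * p ^ 2 * S ^ 2 * hc1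

end JacobiProfile

section Parameters

variable {n m : ℤ}

theorem paramB_cube (hm : 0 < m) (hn : 0 < n) :
    paramB n m ^ 3 = (n : ℝ) * (n + m) / (2 * m ^ 2) := by
  rw [paramB, ← Real.rpow_natCast, ← Real.rpow_mul (by positivity)]
  norm_num

theorem one_div_two_mul_paramB_cube (hm : 0 < m) (hn : 0 < n) :
    1 / (2 * paramB n m ^ 3) = (m : ℝ) ^ 2 / (n * (n + m)) := by
  rw [paramB_cube hm hn]
  field_simp

theorem paramB_pos (hm : 0 < m) (hn : 0 < n) : 0 < paramB n m :=
  Real.rpow_pos_of_pos (by positivity) _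

theorem paramR_sq (hm : 0 < m) (hn : 0 < n) :
    paramR n m ^ 2 = (n : ℝ) * (n + 2 * m) / (2 * paramB n m ^ 2 * m ^ 2) :=
  Real.sq_sqrt (by positivity)

theorem paramR_pos (hm : 0 < m) (hn : 0 < n) : 0 < paramR n m := by
  have hb := paramB_pos hm hn
  exact Real.sqrt_pos.2 (by positivity)

theorem modulus_sq (hm : 0 < m) (hmn : m ≤ n) :
    modulus n m ^ 2 = ((n : ℝ) ^ 2 - m ^ 2) / (n * (n + 2 * m)) := by
  have hn : 0 < n := hm.trans_le hmn
  have hmn' : (m : ℝ) ≤ n := mod_cast hmn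
  exact Real.sq_sqrt (div_nonneg (sub_nonneg.2 (by gcongr)) (by positivity))

theorem modulus_pos (hm : 0 < m) (hmn : m < n) : 0 < modulus n m := by
  have hn : 0 < n := hm.trans hmn
  have hmn' : (m : ℝ) < n := mod_cast hmn
  exact Real.sqrt_pos.2 (div_pos (sub_pos.2 (by gcongr)) (by positivity))

theorem abs_modulus_lt_one (hm : 0 < m) (hmn : m ≤ n) : |modulus n m| < 1 := by
  have hn : 0 < n := hm.trans_le hmn
  have hm' : 0 < (m : ℝ) := mod_cast hm
  have hn' : 0 < (n : ℝ) := mod_cast hn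
  rw [← sq_lt_one_iff_abs_lt_one, modulus_sq hm hmn, div_lt_one (by positivity)]
  nlinarith

/-- The coefficients `λ, μ, ν` of the immersion. -/
noncomputable def liftCoeff (n m : ℤ) : Fin 3 → ℝ :=
  ![√((n : ℝ) / (2 * n + m)), √(((n : ℝ) + m) / (2 * n + m)), √(((n : ℝ) + m) / (n + 2 * m))]

/-- The frequencies in `y` of the coordinates of the immersion. -/
noncomputable def liftFrequency (n m : ℤ) : Fin 3 → ℝ :=
  ![((n : ℝ) + m) / (√2 * m * paramB n m), -(n / (√2 * m * paramB n m)), -(1 / (√2 * paramB n m))]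

theorem liftCoeff_zero_sq (hm : 0 < m) (hn : 0 < n) :
    liftCoeff n m 0 ^ 2 = (n : ℝ) / (2 * n + m) :=
  Real.sq_sqrt (by positivity)

theorem liftCoeff_one_sq (hm : 0 < m) (hn : 0 < n) :
    liftCoeff n m 1 ^ 2 = ((n : ℝ) + m) / (2 * n + m) :=
  Real.sq_sqrt (by positivity)

theorem liftCoeff_two_sq (hm : 0 < m) (hn : 0 < n) :
    liftCoeff n m 2 ^ 2 = ((n : ℝ) + m) / (n + 2 * m) :=
  Real.sq_sqrt (by positivity)

theorem liftCoeff_zero_sq_add_one_sq (hm : 0 < m) (hn : 0 < n) :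
    liftCoeff n m 0 ^ 2 + liftCoeff n m 1 ^ 2 = 1 := by
  rw [liftCoeff_zero_sq hm hn, liftCoeff_one_sq hm hn]
  field_simp
  ring

theorem liftCoeff_two_sq_eq (hm : 0 < m) (hmn : m ≤ n) :
    liftCoeff n m 2 ^ 2 =
      liftCoeff n m 0 ^ 2 * modulus n m ^ 2 + liftCoeff n m 1 ^ 2 := by
  have hn : 0 < n := hm.trans_le hmn
  rw [liftCoeff_zero_sq hm hn, liftCoeff_one_sq hm hn, liftCoeff_two_sq hm hn, modulus_sq hm hmn]
  field_simp
  ring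

theorem immersionLift_eq_phaseSurface (n m : ℤ) :
    immersionLift n m = phaseSurface (liftFrequency n m)
      (jacobiProfile (liftCoeff n m) (modulus n m) (paramR n m)) := by
  ext q i
  fin_cases i <;> refine congrArg (_ * Complex.exp ·) ?_ <;> simp [liftFrequency] <;> ring

/-- The conformal factor of the metric of `K_{n,m}` with respect to the flat metric of the plane,
a function of the first coordinate. -/
noncomputable def conformalFactor (n m : ℤ) (x : ℝ) : ℝ :=
  paramR n m ^ 2 * (((n : ℝ) + m) / (n + 2 * m) -
    modulus n m ^ 2 * jacobiSn (modulus n m) (paramR n m * x) ^ 2)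

theorem sum_liftFrequency_mul_sq (hm : 0 < m) (hmn : m ≤ n) (x : ℝ) :
    ∑ i, liftFrequency n m i *
      jacobiProfile (liftCoeff n m) (modulus n m) (paramR n m) x i ^ 2 = 0 := by
  have hn : 0 < n := hm.trans_le hmn
  have hb := paramB_pos hm hn
  simp only [liftFrequency, jacobiProfile, Fin.sum_univ_three, Matrix.cons_val_zero,
    Matrix.cons_val_one, Matrix.cons_val, mul_pow, liftCoeff_zero_sq hm hn,
    liftCoeff_one_sq hm hn, liftCoeff_two_sq hm hn, jacobiCn_sq,
    jacobiDn_sq (abs_modulus_lt_one hm hmn), modulus_sq hm hmn]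
  field_simp
  ring

theorem sum_liftFrequency_sq_mul_sq (hm : 0 < m) (hmn : m ≤ n) (x : ℝ) :
    ∑ i, liftFrequency n m i ^ 2 *
      jacobiProfile (liftCoeff n m) (modulus n m) (paramR n m) x i ^ 2 =
        conformalFactor n m x := by
  have hn : 0 < n := hm.trans_le hmn
  have hb := paramB_pos hm hn
  simp only [liftFrequency, jacobiProfile, conformalFactor, Fin.sum_univ_three,
    Matrix.cons_val_zero, Matrix.cons_val_one, Matrix.cons_val, mul_pow, neg_sq, div_pow,
    one_pow, Real.sq_sqrt (zero_le_two (α := ℝ)), paramR_sq hm hn,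
    liftCoeff_zero_sq hm hn, liftCoeff_one_sq hm hn, liftCoeff_two_sq hm hn, jacobiCn_sq,
    jacobiDn_sq (abs_modulus_lt_one hm hmn), modulus_sq hm hmn]
  field_simp
  ring

theorem kleinMetric_eq_smul_one (hm : 0 < m) (hmn : m ≤ n) (q : ℝ × ℝ) :
    kleinMetric n m q = conformalFactor n m q.1 • (1 : Matrix (Fin 2) (Fin 2) ℝ) := by
  have hp := abs_modulus_lt_one hm hmn
  have hn : 0 < n := hm.trans_le hmn
  have hspeed := sum_jacobiProfileDeriv_sq hp (liftCoeff_two_sq_eq hm hmn)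
    (liftCoeff_zero_sq_add_one_sq hm hn) (paramR n m) q.1
  rw [liftCoeff_two_sq hm hn, ← conformalFactor] at hspeed
  rw [kleinMetric, immersionLift_eq_phaseSurface,
    inducedMetric_phaseSurface (hasDerivAt_jacobiProfile hp _ _)
      (sum_jacobiProfile_mul_deriv (liftCoeff_two_sq_eq hm hmn) _ _)
      (sum_liftFrequency_mul_sq hm hmn _),
    hspeed, sum_liftFrequency_sq_mul_sq hm hmn, Matrix.smul_one_eq_diagonal]
  exact congrArg Matrix.diagonal (List.ofFn_inj.1 rfl)

/-- The quarter period `K / r` of the immersion. -/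
noncomputable def quarterPeriod (n m : ℤ) : ℝ := ellipticK (modulus n m) / paramR n m

theorem quarterPeriod_pos (hm : 0 < m) (hmn : m ≤ n) : 0 < quarterPeriod n m :=
  div_pos (ellipticK_pos (abs_modulus_lt_one hm hmn)) (paramR_pos hm (hm.trans_le hmn))

theorem paramR_mul_quarterPeriod (hm : 0 < m) (hn : 0 < n) :
    paramR n m * quarterPeriod n m = ellipticK (modulus n m) :=
  mul_div_cancel₀ _ (paramR_pos hm hn).ne'

theorem conformalFactor_pos (hm : 0 < m) (hmn : m ≤ n) (x : ℝ) : 0 < conformalFactor n m x := by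
  have hn : 0 < n := hm.trans_le hmn
  have hsn : jacobiSn (modulus n m) (paramR n m * x) ^ 2 ≤ 1 := Real.sin_sq_le_one _
  refine mul_pos (pow_pos (paramR_pos hm hn) 2) (sub_pos.2 ?_)
  calc modulus n m ^ 2 * jacobiSn (modulus n m) (paramR n m * x) ^ 2
      ≤ modulus n m ^ 2 := mul_le_of_le_one_right (sq_nonneg _) hsn
    _ < (n + m) / (n + 2 * m) := by
      rw [modulus_sq hm hmn, ← sub_pos]
      have : ((n : ℝ) + m) / (n + 2 * m) - (n ^ 2 - m ^ 2) / (n * (n + 2 * m)) =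
          m * (n + m) / (n * (n + 2 * m)) := by
        field_simp
        ring
      rw [this]
      positivity

theorem contDiff_conformalFactor (hm : 0 < m) (hmn : m ≤ n) :
    ContDiff ℝ ∞ (conformalFactor n m) := by
  have hsn := contDiff_jacobiSn (abs_modulus_lt_one hm hmn)
  unfold conformalFactor
  fun_prop

theorem conformalFactor_even (hm : 0 < m) (hmn : m ≤ n) : (conformalFactor n m).Even := fun x => by
  simp only [conformalFactor, mul_neg, jacobiSn_neg (abs_modulus_lt_one hm hmn), neg_sq]

theorem conformalFactor_two_mul_sub (hm : 0 < m) (hmn : m ≤ n) (x : ℝ) :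
    conformalFactor n m (2 * quarterPeriod n m - x) = conformalFactor n m x := by
  rw [conformalFactor, mul_sub (paramR n m), mul_left_comm,
    paramR_mul_quarterPeriod hm (hm.trans_le hmn), jacobiSn_two_mul_sub (abs_modulus_lt_one hm hmn),
    conformalFactor]

theorem periodic_two_mul_of_even {f : ℝ → ℝ} {A : ℝ} (heven : f.Even)
    (hsymm : ∀ x, f (2 * A - x) = f x) : f.Periodic (2 * A) := fun x => by
  rw [← hsymm, sub_add_cancel_right, heven]

theorem conformalFactor_periodic (hm : 0 < m) (hmn : m ≤ n) :
    (conformalFactor n m).Periodic (2 * quarterPeriod n m) :=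
  periodic_two_mul_of_even (conformalFactor_even hm hmn) (conformalFactor_two_mul_sub hm hmn)

end Parameters

/-! ### Klein bottles as quotients of the plane -/

section ConformalMetric

variable {ρ : ℝ × ℝ → ℝ} {g : ℝ × ℝ → Matrix (Fin 2) (Fin 2) ℝ}

theorem areaDensity_of_eq_smul_one {q : ℝ × ℝ} (hρ : 0 ≤ ρ q) (hg : g q = ρ q • 1) :
    areaDensity g q = ρ q := by
  rw [areaDensity, hg, Matrix.det_smul, Matrix.det_one, mul_one, Fintype.card_fin,
    Real.sqrt_sq hρ]

theorem laplaceBeltrami_of_eq_smul_one (hρ : ∀ q, 0 < ρ q) (hg : ∀ q, g q = ρ q • 1)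
    (f : ℝ × ℝ → ℝ) (q : ℝ × ℝ) :
    laplaceBeltrami g f q =
      (ρ q)⁻¹ * (pderiv 0 (pderiv 0 f) q + pderiv 1 (pderiv 1 f) q) := by
  have hgrad (i : Fin 2) :
      (fun q => areaDensity g q * ∑ j, (g q)⁻¹ i j * pderiv j f q) = pderiv i f := by
    ext q
    have hinv : (g q)⁻¹ = (ρ q)⁻¹ • 1 := by
      refine Matrix.inv_eq_right_inv ?_
      rw [hg, Matrix.smul_mul, one_mul, smul_smul, mul_inv_cancel₀ (hρ q).ne', one_smul]
    simp [areaDensity_of_eq_smul_one (hρ q).le (hg q), hinv, Matrix.smul_apply, Matrix.one_apply,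
      (hρ q).ne']
  rw [laplaceBeltrami, areaDensity_of_eq_smul_one (hρ q).le (hg q), Fin.sum_univ_two, hgrad,
    hgrad]

end ConformalMetric

theorem apply_eq_of_mem_closure {α β : Type*} {S : Set (Equiv.Perm α)} {F : α → β}
    (hF : ∀ s ∈ S, ∀ q, F (s q) = F q) {s : Equiv.Perm α} (hs : s ∈ Subgroup.closure S) (q : α) :
    F (s q) = F q := by
  induction hs using Subgroup.closure_induction generalizing q with
  | mem s hs => exact hF s hs q
  | one => rfl
  | mul s t _ _ hs ht => rw [Equiv.Perm.mul_apply, hs, ht]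
  | inv s _ hs => exact (hs (s⁻¹ q)).symm.trans (congrArg F (s.apply_symm_apply q))

theorem mem_positiveEigenvalues_closure {S : Set (Equiv.Perm (ℝ × ℝ))}
    {g : ℝ × ℝ → Matrix (Fin 2) (Fin 2) ℝ} {lam : ℝ} :
    lam ∈ positiveEigenvalues (Subgroup.closure S) g ↔ 0 < lam ∧ ∃ F : ℝ × ℝ → ℝ, F ≠ 0 ∧
      ContDiff ℝ ∞ F ∧ (∀ s ∈ S, ∀ q, F (s q) = F q) ∧
      ∀ q, laplaceBeltrami g F q + lam * F q = 0 := by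
  refine and_congr_right fun _ => ⟨?_, ?_⟩
  · rintro ⟨f, hf0, hf, heq⟩
    refine ⟨f ∘ PlaneQuotient.proj _, fun h => hf0 ?_, hf, fun s hs q => ?_, heq⟩
    · exact (Quotient.mk_surjective (s := MulAction.orbitRel _ _)).injective_comp_right h
    · exact congrArg f (Quotient.sound ⟨⟨s, Subgroup.subset_closure hs⟩, rfl⟩)
  · rintro ⟨F, hF0, hF, hinv, heq⟩
    refine ⟨Quotient.lift F ?_, fun h => hF0 ?_, hF, heq⟩
    · rintro _ q ⟨s, rfl⟩
      exact apply_eq_of_mem_closure hinv s.2 q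
    · exact congrArg (· ∘ PlaneQuotient.proj (Subgroup.closure S)) h

/-- The group with quotient a Klein bottle that is generated by `(x, y) ↦ (x + a, y)` and
`(x, y) ↦ (-x, y + c)`. -/
def glideGroup (a c : ℝ) : Subgroup (Equiv.Perm (ℝ × ℝ)) :=
  Subgroup.closure {translationX a, glideReflection c}

section GlideGroup

variable {a c : ℝ}

theorem exists_forall_apply_eq_of_mem_glideGroup {s : Equiv.Perm (ℝ × ℝ)}
    (hs : s ∈ glideGroup a c) :
    ∃ j k : ℤ, ∀ q, s q = ((k.negOnePow : ℤ) * q.1 + j * a, q.2 + k * c) := by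
  induction hs using Subgroup.closure_induction with
  | mem s hs =>
    rcases hs with rfl | rfl
    · exact ⟨1, 0, fun q => by simp [translationX]⟩
    · exact ⟨0, 1, fun q => by simp [glideReflection]⟩
  | one => exact ⟨0, 0, fun q => by simp⟩
  | mul s t _ _ hs ht =>
    obtain ⟨j, k, hs⟩ := hs
    obtain ⟨j', k', ht⟩ := ht
    refine ⟨(k.negOnePow : ℤ) * j' + j, k + k', fun q => ?_⟩
    rw [Equiv.Perm.mul_apply, ht, hs, Int.negOnePow_add]
    ext <;> push_cast <;> ring
  | inv s _ hs =>
    obtain ⟨j, k, hs⟩ := hs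
    have hk : ((k.negOnePow : ℤ) : ℝ) * (k.negOnePow : ℤ) = 1 := by
      rw [← Int.cast_mul, ← Units.val_mul, Int.units_mul_self, Units.val_one, Int.cast_one]
    refine ⟨-(k.negOnePow : ℤ) * j, -k, fun q => ?_⟩
    rw [Equiv.Perm.inv_eq_iff_eq, hs, Int.negOnePow_neg]
    ext <;> push_cast
    · linear_combination (j * a - q.1) * hk
    · ring

theorem translationX_zpow_apply (a : ℝ) (j : ℤ) (q : ℝ × ℝ) :
    (translationX a ^ j) q = (q.1 + j * a, q.2) := by
  induction j generalizing q with
  | zero => simp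
  | succ j ih =>
    rw [zpow_add_one, Equiv.Perm.mul_apply, ih]
    refine Prod.ext ?_ rfl
    simp only [translationX, Equiv.coe_fn_mk]
    push_cast
    ring
  | pred j ih =>
    have hinv : (translationX a)⁻¹ q = (q.1 - a, q.2) := rfl
    rw [zpow_sub_one, Equiv.Perm.mul_apply, ih, hinv]
    refine Prod.ext ?_ rfl
    push_cast
    ring

theorem glideReflection_zpow_apply (c : ℝ) (k : ℤ) (q : ℝ × ℝ) :
    (glideReflection c ^ k) q = ((k.negOnePow : ℤ) * q.1, q.2 + k * c) := by
  induction k generalizing q with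
  | zero => simp
  | succ k ih =>
    rw [zpow_add_one, Equiv.Perm.mul_apply, ih, Int.negOnePow_succ]
    ext <;> simp only [glideReflection, Equiv.coe_fn_mk] <;> push_cast <;> ring
  | pred k ih =>
    have hinv : (glideReflection c)⁻¹ q = (-q.1, q.2 - c) := rfl
    rw [zpow_sub_one, Equiv.Perm.mul_apply, ih, hinv, Int.negOnePow_sub, Int.negOnePow_one]
    ext <;> push_cast <;> ring

theorem existsUnique_smul_mem_Ico_prod_Ico (ha : 0 < a) (hc : 0 < c) (q : ℝ × ℝ) :
    ∃! s : glideGroup a c, s • q ∈ Set.Ico 0 a ×ˢ Set.Ico 0 c := by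
  obtain ⟨k, hk, hk_unique⟩ := existsUnique_add_zsmul_mem_Ico hc q.2 0
  obtain ⟨j, hj, hj_unique⟩ := existsUnique_add_zsmul_mem_Ico ha ((k.negOnePow : ℤ) * q.1) 0
  simp only [zsmul_eq_mul, zero_add] at hk hk_unique hj hj_unique
  have ht : translationX a ∈ glideGroup a c := Subgroup.subset_closure (Set.mem_insert _ _)
  have hr : glideReflection c ∈ glideGroup a c :=
    Subgroup.subset_closure (Set.mem_insert_of_mem _ rfl)
  let s : glideGroup a c := ⟨translationX a ^ j * glideReflection c ^ k,
    mul_mem (zpow_mem ht j) (zpow_mem hr k)⟩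
  have hs (q : ℝ × ℝ) : s • q = ((k.negOnePow : ℤ) * q.1 + j * a, q.2 + k * c) := by
    rw [Subgroup.smul_def, Equiv.Perm.smul_def, Equiv.Perm.mul_apply, glideReflection_zpow_apply,
      translationX_zpow_apply]
  refine ⟨s, (congrArg (· ∈ _) (hs q)).mpr ⟨hj, hk⟩,
    fun t htq => Subtype.ext (Equiv.ext fun q' => ?_)⟩
  obtain ⟨j', k', ht⟩ := exists_forall_apply_eq_of_mem_glideGroup t.2
  have htq' : t • q = _ := ht q
  simp only [htq'] at htq
  obtain rfl := hk_unique k' htq.2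
  obtain rfl := hj_unique j' htq.1
  exact (ht q').trans (hs q').symm

instance countable_glideGroup : Countable (glideGroup a c) := by
  choose j k h using fun s : glideGroup a c => exists_forall_apply_eq_of_mem_glideGroup s.2
  refine Function.Injective.countable (f := fun s => (j s, k s)) fun s t hst => ?_
  obtain ⟨hj, hk⟩ : j s = j t ∧ k s = k t := Prod.ext_iff.1 hst
  exact Subtype.ext (Equiv.ext fun q => by rw [h, h, hj, hk])

theorem measurePreserving_of_mem_glideGroup {s : Equiv.Perm (ℝ × ℝ)} (hs : s ∈ glideGroup a c) :
    MeasurePreserving s := by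
  obtain ⟨j, k, h⟩ := exists_forall_apply_eq_of_mem_glideGroup hs
  have hfst : MeasurePreserving fun x : ℝ => (k.negOnePow : ℤ) * x + j * a := by
    rcases Int.units_eq_one_or k.negOnePow with hk | hk
    · simpa [hk] using measurePreserving_add_right volume (j * a)
    · simpa [hk, Function.comp_def] using (measurePreserving_add_right volume (j * a)).comp
        (Measure.measurePreserving_neg volume)
  rw [funext h]
  exact hfst.prod (measurePreserving_add_right volume (k * c))

theorem measurePreserving_withDensity {α : Type*} [MeasurableSpace α] {μ : Measure α} {g : α → α}
    (hg : MeasurePreserving g μ μ) {f : α → ENNReal} (hf : Measurable f)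
    (hfg : ∀ x, f (g x) = f x) :
    MeasurePreserving g (μ.withDensity f) (μ.withDensity f) := by
  refine ⟨hg.measurable, Measure.ext fun s hs => ?_⟩
  rw [Measure.map_apply hg.measurable hs, withDensity_apply _ (hg.measurable hs),
    withDensity_apply _ hs, ← hg.setLIntegral_comp_preimage hs hf]
  simp only [hfg]

theorem setLIntegral_Ico_prod_Ico_fst (ha : 0 ≤ a) (c : ℝ) {ρ : ℝ → ℝ} (hρ : Continuous ρ)
    (hnonneg : 0 ≤ ρ) :
    ∫⁻ q in Set.Ico 0 a ×ˢ Set.Ico 0 c, ENNReal.ofReal (ρ q.1) =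
      ENNReal.ofReal ((∫ x in (0 : ℝ)..a, ρ x) * c) := by
  have hint : IntegrableOn ρ (Set.Ico 0 a) := hρ.integrableOn_Icc.mono_set Set.Ico_subset_Icc_self
  calc ∫⁻ q in Set.Ico 0 a ×ˢ Set.Ico 0 c, ENNReal.ofReal (ρ q.1)
      = ∫⁻ q, ENNReal.ofReal (ρ q.1) * 1
          ∂((volume.restrict (Set.Ico 0 a)).prod (volume.restrict (Set.Ico 0 c))) := by
        rw [Measure.prod_restrict, ← Measure.volume_eq_prod]
        simp only [mul_one]
    _ = (∫⁻ x in Set.Ico 0 a, ENNReal.ofReal (ρ x)) * ∫⁻ _ in Set.Ico 0 c, 1 :=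
        lintegral_prod_mul (f := fun x => ENNReal.ofReal (ρ x)) (g := fun _ => 1) (by fun_prop)
          aemeasurable_const
    _ = ENNReal.ofReal ((∫ x in (0 : ℝ)..a, ρ x) * c) := by
        rw [← ofReal_integral_eq_lintegral_ofReal hint (.of_forall hnonneg), setLIntegral_one,
          Real.volume_Ico, sub_zero, ← ENNReal.ofReal_mul (integral_nonneg hnonneg),
          integral_Ico_eq_integral_Ioc, intervalIntegral.integral_of_le ha]

theorem quotientArea_glideGroup (ha : 0 < a) (hc : 0 < c) {ρ : ℝ → ℝ} (hρ : Continuous ρ)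
    (hnonneg : 0 ≤ ρ) (heven : ρ.Even) (hper : ρ.Periodic a)
    {g : ℝ × ℝ → Matrix (Fin 2) (Fin 2) ℝ} (hg : ∀ q, areaDensity g q = ρ q.1) :
    quotientArea (glideGroup a c) g = ENNReal.ofReal ((∫ x in (0 : ℝ)..a, ρ x) * c) := by
  have hmeas : Measurable fun q : ℝ × ℝ => ENNReal.ofReal (ρ q.1) := by fun_prop
  have harea : areaMeasure g = volume.withDensity fun q => ENNReal.ofReal (ρ q.1) := by
    simp only [areaMeasure, hg]
  have hgen : ∀ s ∈ ({translationX a, glideReflection c} : Set (Equiv.Perm (ℝ × ℝ))), ∀ q,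
      ρ (s q).1 = ρ q.1 := by
    rintro s (rfl | rfl) q
    exacts [hper q.1, heven q.1]
  have hinv (s : glideGroup a c) (q : ℝ × ℝ) : ρ (s.1 q).1 = ρ q.1 :=
    apply_eq_of_mem_closure (F := fun q => ρ q.1) hgen s.2 q
  have hmp (s : glideGroup a c) : MeasurePreserving s.1 (areaMeasure g) (areaMeasure g) := by
    rw [harea]
    exact measurePreserving_withDensity (measurePreserving_of_mem_glideGroup s.2) hmeas
      fun q => congrArg ENNReal.ofReal (hinv s q)
  have : MeasurableConstSMul (glideGroup a c) (ℝ × ℝ) := ⟨fun s => (hmp s).measurable⟩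
  have : SMulInvariantMeasure (glideGroup a c) (ℝ × ℝ) (areaMeasure g) :=
    ⟨fun s t ht => (hmp s).measure_preimage ht.nullMeasurableSet⟩
  have hrect : MeasurableSet (Set.Ico 0 a ×ˢ Set.Ico 0 c : Set (ℝ × ℝ)) :=
    measurableSet_Ico.prod measurableSet_Ico
  have hdomain : IsFundamentalDomain (glideGroup a c) (Set.Ico 0 a ×ˢ Set.Ico 0 c)
      (areaMeasure g) :=
    .mk' hrect.nullMeasurableSet (existsUnique_smul_mem_Ico_prod_Ico ha hc)
  rw [quotientArea, hdomain.covolume_eq_volume, harea, withDensity_apply _ hrect,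
    setLIntegral_Ico_prod_Ico_fst ha.le c hρ hnonneg]

end GlideGroup

section Klein

variable {n m : ℤ}

/-- The glide length `√2 m b π / 3` of the Klein bottle. -/
noncomputable def glideLength (n m : ℤ) : ℝ := √2 * m * paramB n m * Real.pi / 3

theorem glideLength_pos (hm : 0 < m) (hn : 0 < n) : 0 < glideLength n m := by
  have := paramB_pos hm hn
  exact div_pos (by positivity) three_pos

theorem kleinGroup_eq_glideGroup (n m : ℤ) :
    kleinGroup n m = glideGroup (4 * quarterPeriod n m) (glideLength n m) := by
  rw [kleinGroup, glideGroup, quarterPeriod, glideLength, mul_div_assoc]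

theorem mem_kleinPositiveEigenvalues (hm : 0 < m) (hmn : m ≤ n) {lam : ℝ} :
    lam ∈ kleinPositiveEigenvalues n m ↔ 0 < lam ∧ ∃ F : ℝ × ℝ → ℝ, F ≠ 0 ∧ ContDiff ℝ ∞ F ∧
      (∀ x y, F (x + 4 * quarterPeriod n m, y) = F (x, y)) ∧
      (∀ x y, F (-x, y + glideLength n m) = F (x, y)) ∧
      ∀ q, pderiv 0 (pderiv 0 F) q + pderiv 1 (pderiv 1 F) q +
        lam * conformalFactor n m q.1 * F q = 0 := by
  have hgen (F : ℝ × ℝ → ℝ) : (∀ s ∈ ({translationX (4 * quarterPeriod n m),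
      glideReflection (glideLength n m)} : Set (Equiv.Perm (ℝ × ℝ))), ∀ q, F (s q) = F q) ↔
      (∀ x y, F (x + 4 * quarterPeriod n m, y) = F (x, y)) ∧
        ∀ x y, F (-x, y + glideLength n m) = F (x, y) := by
    simp only [Set.forall_mem_insert, Set.mem_singleton_iff, forall_eq, Prod.forall]
    rfl
  rw [kleinPositiveEigenvalues, kleinGroup_eq_glideGroup, glideGroup,
    mem_positiveEigenvalues_closure]
  simp only [hgen, and_assoc]
  refine and_congr_right fun _ => exists_congr fun F => and_congr_right fun _ =>
    and_congr_right fun _ => and_congr_right fun _ => and_congr_right fun _ =>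
      forall_congr' fun q => ?_
  have hρ := (conformalFactor_pos hm hmn q.1).ne'
  rw [laplaceBeltrami_of_eq_smul_one (fun q => conformalFactor_pos hm hmn q.1)
    (kleinMetric_eq_smul_one hm hmn), ← mul_right_inj' hρ, mul_zero, mul_add,
    mul_inv_cancel_left₀ hρ, ← mul_assoc, mul_comm (conformalFactor n m q.1)]

theorem integral_zero_four_mul {f : ℝ → ℝ} (hf : Continuous f) {a : ℝ}
    (hs : ∀ x, f (2 * a - x) = f x) (hp : f.Periodic (2 * a)) :
    ∫ x in (0 : ℝ)..4 * a, f x = 4 * ∫ x in (0 : ℝ)..a, f x := by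
  have hi (u v : ℝ) : IntervalIntegrable f volume u v := hf.intervalIntegrable u v
  have hreflect : ∫ x in a..2 * a, f x = ∫ x in (0 : ℝ)..a, f x := by
    have := intervalIntegral.integral_comp_sub_left f (2 * a) (a := 0) (b := a)
    simp only [hs] at this
    rw [this, sub_zero, two_mul, add_sub_cancel_right]
  have hshift : ∫ x in 2 * a..4 * a, f x = ∫ x in (0 : ℝ)..2 * a, f x := by
    have := hp.intervalIntegral_add_eq (2 * a) 0
    rwa [zero_add, ← two_mul, ← mul_assoc, two_mul 2, two_add_two_eq_four] at this
  rw [← intervalIntegral.integral_add_adjacent_intervals (hi 0 (2 * a)) (hi _ _), hshift,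
    ← intervalIntegral.integral_add_adjacent_intervals (hi 0 a) (hi _ _), hreflect]
  ring

theorem conformalFactor_eq_jacobiDn_sq (hm : 0 < m) (hmn : m ≤ n) (x : ℝ) :
    conformalFactor n m x = paramR n m ^ 2 *
      (jacobiDn (modulus n m) (paramR n m * x) ^ 2 - (m : ℝ) / (n + 2 * m)) := by
  have hn : 0 < n := hm.trans_le hmn
  rw [conformalFactor, jacobiDn_sq (abs_modulus_lt_one hm hmn)]
  field_simp
  ring

theorem integral_conformalFactor (hm : 0 < m) (hmn : m ≤ n) :
    ∫ x in (0 : ℝ)..4 * quarterPeriod n m, conformalFactor n m x =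
      4 * (paramR n m *
        (ellipticE (modulus n m) - m / (n + 2 * m) * ellipticK (modulus n m))) := by
  have hp := abs_modulus_lt_one hm hmn
  have hn : 0 < n := hm.trans_le hmn
  have hr := (paramR_pos hm hn).ne'
  have hdn : Continuous (jacobiDn (modulus n m)) :=
    continuous_iff_continuousAt.2 fun x => (hasDerivAt_jacobiDn hp x).continuousAt
  rw [integral_zero_four_mul (contDiff_conformalFactor hm hmn).continuous
    (conformalFactor_two_mul_sub hm hmn) (conformalFactor_periodic hm hmn)]
  simp only [conformalFactor_eq_jacobiDn_sq hm hmn]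
  rw [intervalIntegral.integral_const_mul, intervalIntegral.integral_comp_mul_left
      (fun t => jacobiDn (modulus n m) t ^ 2 - (m : ℝ) / (n + 2 * m)) hr, mul_zero,
    paramR_mul_quarterPeriod hm hn,
    intervalIntegral.integral_sub
      (f := fun t => jacobiDn (modulus n m) t ^ 2) ((hdn.pow 2).intervalIntegrable _ _)
      intervalIntegrable_const,
    integral_jacobiDn_sq hp, intervalIntegral.integral_const, sub_zero, smul_eq_mul, smul_eq_mul,
    sq, mul_assoc, mul_inv_cancel_left₀ hr, mul_comm (ellipticK _)]

theorem paramR_mul_glideLength (hm : 0 < m) (hn : 0 < n) :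
    paramR n m * glideLength n m = Real.pi / 3 * (√(n : ℝ) * √((n : ℝ) + 2 * m)) := by
  have hb := paramB_pos hm hn
  have hn' : 0 ≤ (n : ℝ) := mod_cast hn.le
  rw [← Real.sqrt_mul hn', paramR, Real.sqrt_div (by positivity), glideLength, mul_assoc 2,
    ← mul_pow, Real.sqrt_mul zero_le_two, Real.sqrt_sq (by positivity)]
  field_simp

theorem kleinArea_eq (hm : 0 < m) (hmn : m ≤ n) :
    kleinArea n m = ENNReal.ofReal (4 * Real.pi * √(n : ℝ) / (3 * √((n : ℝ) + 2 * m)) *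
      (((n : ℝ) + 2 * m) * ellipticE (modulus n m) - m * ellipticK (modulus n m))) := by
  have hn : 0 < n := hm.trans_le hmn
  have hper : (conformalFactor n m).Periodic (4 * quarterPeriod n m) := by
    have := (conformalFactor_periodic hm hmn).nsmul 2
    rwa [two_nsmul, ← add_mul, two_add_two_eq_four] at this
  rw [kleinArea, kleinGroup_eq_glideGroup, quotientArea_glideGroup
    (mul_pos four_pos (quarterPeriod_pos hm hmn)) (glideLength_pos hm hn)
    (contDiff_conformalFactor hm hmn).continuous (fun x => (conformalFactor_pos hm hmn x).le)
    (conformalFactor_even hm hmn) hper fun q =>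
      areaDensity_of_eq_smul_one (ρ := fun q => conformalFactor n m q.1)
        (conformalFactor_pos hm hmn q.1).le (kleinMetric_eq_smul_one hm hmn q),
    integral_conformalFactor hm hmn]
  congr 1
  rw [mul_assoc, mul_right_comm, paramR_mul_glideLength hm hn]
  field_simp
  rw [Real.sq_sqrt (by positivity)]

end Klein

/-! ### Discreteness of the spectrum of a conformally flat torus -/

section IntervalPoincare

variable {g g' : ℝ → ℝ} {a b : ℝ}

theorem integral_sub_average_sq (hg : Continuous g) (hab : a ≠ b) :
    ∫ x in a..b, (g x - (b - a)⁻¹ * ∫ t in a..b, g t) ^ 2 =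
      (∫ x in a..b, g x ^ 2) - (b - a)⁻¹ * (∫ x in a..b, g x) ^ 2 := by
  have hne : b - a ≠ 0 := sub_ne_zero.2 hab.symm
  set M := ∫ t in a..b, g t with hM
  have hexpand (x : ℝ) : (g x - (b - a)⁻¹ * M) ^ 2 =
      g x ^ 2 - 2 * (b - a)⁻¹ * M * g x + ((b - a)⁻¹ * M) ^ 2 := by ring
  simp only [hexpand]
  rw [intervalIntegral.integral_add, intervalIntegral.integral_sub,
    intervalIntegral.integral_const_mul, ← hM, intervalIntegral.integral_const, smul_eq_mul]
  · field_simp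
    ring
  all_goals exact Continuous.intervalIntegrable (by fun_prop) _ _

theorem sq_integral_le (hg : Continuous g) (hab : a ≤ b) :
    (∫ x in a..b, g x) ^ 2 ≤ (b - a) * ∫ x in a..b, g x ^ 2 := by
  rcases hab.eq_or_lt with rfl | hab
  · simp
  have hnonneg : 0 ≤ ∫ x in a..b, (g x - (b - a)⁻¹ * ∫ t in a..b, g t) ^ 2 :=
    intervalIntegral.integral_nonneg hab.le fun x _ => sq_nonneg _
  rw [integral_sub_average_sq hg hab.ne, sub_nonneg] at hnonneg
  exact (inv_mul_le_iff₀ (sub_pos.2 hab)).1 hnonneg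

theorem sq_sub_le_of_hasDerivAt (hg : ∀ x, HasDerivAt g (g' x) x) (hg' : Continuous g') {u v : ℝ}
    (hu : u ∈ Set.Icc a b) (hv : v ∈ Set.Icc a b) :
    (g v - g u) ^ 2 ≤ (b - a) * ∫ x in a..b, g' x ^ 2 := by
  wlog huv : u ≤ v generalizing u v
  · simpa only [sub_sq_comm (g v)] using this hv hu (le_of_not_ge huv)
  have hsq : Continuous fun x => g' x ^ 2 := by fun_prop
  rw [← intervalIntegral.integral_eq_sub_of_hasDerivAt (fun x _ => hg x)
    (hg'.intervalIntegrable _ _)]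
  calc (∫ x in u..v, g' x) ^ 2 ≤ (v - u) * ∫ x in u..v, g' x ^ 2 := sq_integral_le hg' huv
    _ ≤ (b - a) * ∫ x in a..b, g' x ^ 2 :=
        mul_le_mul (sub_le_sub hv.2 hu.1)
          (intervalIntegral.integral_mono_interval hu.1 huv hv.2 (.of_forall fun x => sq_nonneg _)
            (hsq.intervalIntegrable _ _))
          (intervalIntegral.integral_nonneg huv fun x _ => sq_nonneg _)
          (sub_nonneg.2 (hu.1.trans hu.2))

theorem integral_sq_le_of_hasDerivAt (hg : ∀ x, HasDerivAt g (g' x) x) (hg' : Continuous g')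
    (hab : a < b) :
    ∫ x in a..b, g x ^ 2 ≤
      (b - a)⁻¹ * (∫ x in a..b, g x) ^ 2 + (b - a) ^ 2 * ∫ x in a..b, g' x ^ 2 := by
  have hcont : Continuous g := continuous_iff_continuousAt.2 fun x => (hg x).continuousAt
  obtain ⟨ξ, hξ, hmean⟩ := exists_eq_interval_average hab.ne hcont.continuousOn
  rw [interval_average_eq, smul_eq_mul] at hmean
  rw [Set.uIoo_of_le hab.le] at hξ
  rw [← sub_le_iff_le_add', ← integral_sub_average_sq hcont hab.ne, ← hmean]
  calc ∫ x in a..b, (g x - g ξ) ^ 2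
      ≤ ∫ _ in a..b, (b - a) * ∫ x in a..b, g' x ^ 2 :=
        intervalIntegral.integral_mono_on hab.le (Continuous.intervalIntegrable (by fun_prop) _ _)
          intervalIntegrable_const fun x hx =>
            sq_sub_le_of_hasDerivAt hg hg' (Set.Ioo_subset_Icc_self hξ) hx
    _ = (b - a) ^ 2 * ∫ x in a..b, g' x ^ 2 := by
        rw [intervalIntegral.integral_const, smul_eq_mul, ← mul_assoc, sq]

end IntervalPoincare

section RectanglePoincare

variable {f : ℝ × ℝ → ℝ}

theorem continuous_pderiv (hf : ContDiff ℝ 1 f) (i : Fin 2) : Continuous (pderiv i f) :=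
  (hf.continuous_fderiv one_ne_zero).clm_apply continuous_const

theorem setIntegral_Icc_prod (hf : Continuous f) {p q : ℝ × ℝ} (hpq : p ≤ q) :
    ∫ z in Set.Icc p q, f z = ∫ x in p.1..q.1, ∫ y in p.2..q.2, f (x, y) := by
  have hint : IntegrableOn f (Set.Icc p q) := hf.integrableOn_Icc
  rw [Set.Icc_prod_eq, Measure.volume_eq_prod] at hint ⊢
  rw [setIntegral_prod f hint, integral_Icc_eq_integral_Ioc,
    intervalIntegral.integral_of_le hpq.1]
  simp only [integral_Icc_eq_integral_Ioc, intervalIntegral.integral_of_le hpq.2]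

theorem setIntegral_Icc_prod_swap (hf : Continuous f) {p q : ℝ × ℝ} (hpq : p ≤ q) :
    ∫ z in Set.Icc p q, f z = ∫ y in p.2..q.2, ∫ x in p.1..q.1, f (x, y) := by
  have hswap := setIntegral_prod_swap (μ := volume) (ν := volume) (Set.Icc p.1 q.1)
    (Set.Icc p.2 q.2) f
  rw [← Measure.volume_eq_prod, ← Set.Icc_prod_eq p q, Set.Icc_prod_Icc] at hswap
  rw [← hswap]
  exact setIntegral_Icc_prod (f := fun z => f z.swap) (by fun_prop) (Prod.swap_le_swap.2 hpq)

theorem continuous_integral_fst (hf : Continuous f) (a b : ℝ) :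
    Continuous fun y => ∫ x in a..b, f (x, y) :=
  intervalIntegral.continuous_parametric_intervalIntegral_of_continuous'
    (f := fun y x => f (x, y)) (by fun_prop) a b

theorem hasDerivAt_integral_fst (hf : ContDiff ℝ 1 f) (a b y : ℝ) :
    HasDerivAt (fun y => ∫ x in a..b, f (x, y)) (∫ x in a..b, pderiv 1 f (x, y)) y := by
  have hcont := hf.continuous
  have hcont' := continuous_pderiv hf 1
  obtain ⟨C, hC⟩ := ((isCompact_uIcc (a := a) (b := b)).prod
    (isCompact_closedBall y 1)).exists_bound_of_continuousOn hcont'.continuousOn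
  refine (intervalIntegral.hasDerivAt_integral_of_dominated_loc_of_deriv_le
    (F := fun y x => f (x, y)) (F' := fun y x => pderiv 1 f (x, y)) (bound := fun _ => C)
    (Metric.closedBall_mem_nhds y one_pos) (.of_forall fun y => ?_) ?_ ?_ ?_
    intervalIntegrable_const ?_).2
  · exact Continuous.aestronglyMeasurable (by fun_prop)
  · exact Continuous.intervalIntegrable (by fun_prop) _ _
  · exact Continuous.aestronglyMeasurable (by fun_prop)
  · exact .of_forall fun x hx z hz => hC (x, z) ⟨Set.uIoc_subset_uIcc hx, hz⟩
  · exact .of_forall fun x _ z _ =>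
      hasDerivAt_snd (q := (x, z)) (hf.differentiable one_ne_zero _)

theorem integral_sq_integral_fst_le (hf : ContDiff ℝ 1 f) {p q : ℝ × ℝ} (hx : p.1 ≤ q.1)
    (hy : p.2 < q.2) :
    ∫ y in p.2..q.2, (∫ x in p.1..q.1, f (x, y)) ^ 2 ≤
      (q.2 - p.2)⁻¹ * (∫ z in Set.Icc p q, f z) ^ 2 +
        (q.2 - p.2) ^ 2 * ((q.1 - p.1) * ∫ z in Set.Icc p q, pderiv 1 f z ^ 2) := by
  have hcont := continuous_pderiv hf 1
  have hsq : Continuous fun z => pderiv 1 f z ^ 2 := by fun_prop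
  have hinner := continuous_integral_fst hcont p.1 q.1
  have hbound : ∫ y in p.2..q.2, (∫ x in p.1..q.1, pderiv 1 f (x, y)) ^ 2 ≤
      ∫ y in p.2..q.2, (q.1 - p.1) * ∫ x in p.1..q.1, pderiv 1 f (x, y) ^ 2 :=
    intervalIntegral.integral_mono_on hy.le (Continuous.intervalIntegrable (by fun_prop) _ _)
      ((continuous_integral_fst hsq _ _).const_mul _ |>.intervalIntegrable _ _)
      fun y _ => sq_integral_le (by fun_prop) hx
  rw [intervalIntegral.integral_const_mul, ← setIntegral_Icc_prod_swap hsq ⟨hx, hy.le⟩] at hbound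
  rw [setIntegral_Icc_prod_swap hf.continuous ⟨hx, hy.le⟩]
  refine (integral_sq_le_of_hasDerivAt (hasDerivAt_integral_fst hf p.1 q.1) hinner hy).trans ?_
  gcongr

theorem setIntegral_Icc_sq_le (hf : ContDiff ℝ 1 f) {p q : ℝ × ℝ} (hx : p.1 < q.1)
    (hy : p.2 < q.2) :
    ∫ z in Set.Icc p q, f z ^ 2 ≤
      ((q.1 - p.1) * (q.2 - p.2))⁻¹ * (∫ z in Set.Icc p q, f z) ^ 2 +
        (q.1 - p.1) ^ 2 * (∫ z in Set.Icc p q, pderiv 0 f z ^ 2) +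
        (q.2 - p.2) ^ 2 * ∫ z in Set.Icc p q, pderiv 1 f z ^ 2 := by
  have hcont := hf.continuous
  have hcont' := continuous_pderiv hf 0
  have hsq : Continuous fun z => f z ^ 2 := by fun_prop
  have hsq' : Continuous fun z => pderiv 0 f z ^ 2 := by fun_prop
  have hmean := ((continuous_integral_fst hcont p.1 q.1).fun_pow 2).const_mul (q.1 - p.1)⁻¹
  have hslope := (continuous_integral_fst hsq' p.1 q.1).const_mul ((q.1 - p.1) ^ 2)
  have hwidth : 0 < q.1 - p.1 := sub_pos.2 hx
  have hheight : 0 < q.2 - p.2 := sub_pos.2 hy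
  calc ∫ z in Set.Icc p q, f z ^ 2
      = ∫ y in p.2..q.2, ∫ x in p.1..q.1, f (x, y) ^ 2 :=
        setIntegral_Icc_prod_swap hsq ⟨hx.le, hy.le⟩
    _ ≤ ∫ y in p.2..q.2, ((q.1 - p.1)⁻¹ * (∫ x in p.1..q.1, f (x, y)) ^ 2 +
          (q.1 - p.1) ^ 2 * ∫ x in p.1..q.1, pderiv 0 f (x, y) ^ 2) :=
        intervalIntegral.integral_mono_on hy.le
          ((continuous_integral_fst hsq p.1 q.1).intervalIntegrable _ _)
          ((hmean.add hslope).intervalIntegrable _ _) fun y _ =>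
            integral_sq_le_of_hasDerivAt
              (fun x => hasDerivAt_fst (q := (x, y)) (hf.differentiable one_ne_zero _))
              (by fun_prop) hx
    _ = (q.1 - p.1)⁻¹ * (∫ y in p.2..q.2, (∫ x in p.1..q.1, f (x, y)) ^ 2) +
          (q.1 - p.1) ^ 2 * ∫ z in Set.Icc p q, pderiv 0 f z ^ 2 := by
        rw [intervalIntegral.integral_add (hmean.intervalIntegrable _ _)
          (hslope.intervalIntegrable _ _), intervalIntegral.integral_const_mul,
          intervalIntegral.integral_const_mul, setIntegral_Icc_prod_swap hsq' ⟨hx.le, hy.le⟩]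
    _ ≤ (q.1 - p.1)⁻¹ * ((q.2 - p.2)⁻¹ * (∫ z in Set.Icc p q, f z) ^ 2 +
          (q.2 - p.2) ^ 2 * ((q.1 - p.1) * ∫ z in Set.Icc p q, pderiv 1 f z ^ 2)) +
          (q.1 - p.1) ^ 2 * ∫ z in Set.Icc p q, pderiv 0 f z ^ 2 := by
        gcongr
        exact integral_sq_integral_fst_le hf hx.le hy
    _ = _ := by
        field_simp
        ring

end RectanglePoincare

section Grid

variable {L H : ℝ} {N : ℕ} {f : ℝ × ℝ → ℝ}

/-- The cell with indices `i, j < N` in the subdivision of `[0, L] × [0, H]` into `N × N` equal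
rectangles. -/
def gridCell (L H : ℝ) (N i j : ℕ) : Set (ℝ × ℝ) :=
  Set.Icc (i * (L / N), j * (H / N)) ((i + 1 : ℕ) * (L / N), (j + 1 : ℕ) * (H / N))

theorem sum_integral_grid {g : ℝ → ℝ} (hg : Continuous g) (hN : N ≠ 0) (z : ℝ) :
    ∑ k ∈ Finset.range N, ∫ x in k * (z / N)..(k + 1 : ℕ) * (z / N), g x =
      ∫ x in (0 : ℝ)..z, g x := by
  rw [intervalIntegral.sum_integral_adjacent_intervals (a := fun k : ℕ => (k : ℝ) * (z / N))
    fun k _ => hg.intervalIntegrable _ _, Nat.cast_zero, zero_mul,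
    mul_div_cancel₀ z (Nat.cast_ne_zero.2 hN)]

theorem sum_setIntegral_gridCell (hf : Continuous f) (hL : 0 ≤ L) (hH : 0 ≤ H) (hN : N ≠ 0) :
    ∑ i ∈ Finset.range N, ∑ j ∈ Finset.range N, ∫ z in gridCell L H N i j, f z =
      ∫ z in Set.Icc 0 (L, H), f z := by
  have hle (k : ℕ) {z : ℝ} (hz : 0 ≤ z) : k * (z / N) ≤ (k + 1 : ℕ) * (z / N) := by
    gcongr
    exact k.le_succ
  have hinner (c d : ℝ) : Continuous fun x => ∫ y in c..d, f (x, y) :=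
    continuous_integral_fst (f := fun z => f z.swap) (by fun_prop) c d
  rw [setIntegral_Icc_prod hf (show (0 : ℝ × ℝ) ≤ (L, H) from ⟨hL, hH⟩), Prod.fst_zero,
    Prod.snd_zero, ← sum_integral_grid (hinner 0 H) hN]
  refine Finset.sum_congr rfl fun i _ => ?_
  have hcolumn (x : ℝ) := sum_integral_grid (g := fun y => f (x, y)) (by fun_prop) hN H
  simp only [← hcolumn]
  rw [intervalIntegral.integral_finsetSum fun j _ => (hinner _ _).intervalIntegrable _ _]
  exact Finset.sum_congr rfl fun j _ => setIntegral_Icc_prod hf ⟨hle i hL, hle j hH⟩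

theorem setIntegral_sq_le_of_gridCell (hf : ContDiff ℝ 1 f) (hL : 0 < L) (hH : 0 < H) (hN : N ≠ 0)
    (hmean : ∀ i < N, ∀ j < N, ∫ z in gridCell L H N i j, f z = 0) :
    ∫ z in Set.Icc 0 (L, H), f z ^ 2 ≤ (L ^ 2 + H ^ 2) / N ^ 2 *
      ∫ z in Set.Icc 0 (L, H), (pderiv 0 f z ^ 2 + pderiv 1 f z ^ 2) := by
  have hcont := hf.continuous
  have hcont0 := continuous_pderiv hf 0
  have hcont1 := continuous_pderiv hf 1
  have hlt (k : ℕ) {z : ℝ} (hz : 0 < z) : k * (z / N) < (k + 1 : ℕ) * (z / N) := by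
    gcongr
    exact k.lt_succ_self
  have hside (k : ℕ) (z : ℝ) : ((k + 1 : ℕ) * (z / N) - k * (z / N)) ^ 2 = z ^ 2 / N ^ 2 := by
    push_cast
    ring
  rw [← sum_setIntegral_gridCell (by fun_prop) hL.le hH.le hN,
    ← sum_setIntegral_gridCell (by fun_prop) hL.le hH.le hN, Finset.mul_sum]
  refine Finset.sum_le_sum fun i hi => (Finset.sum_le_sum fun j hj => ?_).trans_eq
    (Finset.mul_sum _ _ _).symm
  have hcell := setIntegral_Icc_sq_le hf (p := (i * (L / N), j * (H / N)))
    (q := ((i + 1 : ℕ) * (L / N), (j + 1 : ℕ) * (H / N))) (hlt i hL) (hlt j hH)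
  rw [← gridCell, hmean i (Finset.mem_range.1 hi) j (Finset.mem_range.1 hj), hside, hside, sq 0,
    mul_zero, mul_zero, zero_add] at hcell
  rw [gridCell, integral_add (f := fun z => pderiv 0 f z ^ 2) (g := fun z => pderiv 1 f z ^ 2)
    (Continuous.integrableOn_Icc (by fun_prop)) (Continuous.integrableOn_Icc (by fun_prop)),
    mul_add, ← gridCell]
  refine hcell.trans ?_
  gcongr
  · exact le_add_of_nonneg_right (sq_nonneg H)
  · exact le_add_of_nonneg_left (sq_nonneg L)

end Grid

section Rayleigh

variable {V : Type*} [AddCommGroup V] [Module ℝ V] {D B : LinearMap.BilinForm ℝ V}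

/-- `v` satisfies the weak eigenvalue equation `D v = lam • B v` for the energy form `D` and the
mass form `B`. -/
def IsWeakEigenvector (D B : LinearMap.BilinForm ℝ V) (lam : ℝ) (v : V) : Prop :=
  v ≠ 0 ∧ ∀ w, D v w = lam * B v w

theorem IsWeakEigenvector.orthogonal (hD : D.IsSymm) (hB : B.IsSymm) {lam mu : ℝ} {v w : V}
    (hv : IsWeakEigenvector D B lam v) (hw : IsWeakEigenvector D B mu w) (hne : lam ≠ mu) :
    B v w = 0 := by
  have heq : lam * B v w = mu * B v w := by
    rw [← hv.2 w, hB.eq v w, ← hw.2 v, hD.eq]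
  exact (mul_eq_mul_right_iff.1 heq).resolve_left hne

theorem rayleigh_sum_le {ι : Type*} [Fintype ι] (hpos : ∀ v ≠ 0, 0 < B v v) {Lam : ℝ}
    {lam : ι → ℝ} {v : ι → V} (hv : ∀ i, IsWeakEigenvector D B (lam i) (v i))
    (hle : ∀ i, lam i ≤ Lam) (horth : ∀ i j, i ≠ j → B (v i) (v j) = 0) {c : ι → ℝ} (hc : c ≠ 0) :
    0 < B (∑ i, c i • v i) (∑ i, c i • v i) ∧
      D (∑ i, c i • v i) (∑ i, c i • v i) ≤ Lam * B (∑ i, c i • v i) (∑ i, c i • v i) := by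
  set x := ∑ i, c i • v i with hx
  have hleft (T : LinearMap.BilinForm ℝ V) (y : V) : T x y = ∑ i, c i * T (v i) y := by
    simp only [hx, map_sum, LinearMap.sum_apply, map_smul, LinearMap.smul_apply, smul_eq_mul]
  have hright (i : ι) : B (v i) x = c i * B (v i) (v i) := by
    rw [hx, map_sum, Finset.sum_eq_single i (fun j _ hj => by rw [map_smul, horth i j hj.symm,
      smul_zero]) (by simp), map_smul, smul_eq_mul]
  have hterm (i : ι) : 0 ≤ c i * (c i * B (v i) (v i)) := by
    rw [← mul_assoc]
    exact mul_nonneg (mul_self_nonneg _) (hpos _ (hv i).1).le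
  simp only [hleft, (hv _).2, hright]
  constructor
  · obtain ⟨i, hi⟩ := Function.ne_iff.1 hc
    refine Finset.sum_pos' (fun i _ => hterm i) ⟨i, Finset.mem_univ i, ?_⟩
    rw [← mul_assoc]
    exact mul_pos (mul_self_pos.2 hi) (hpos _ (hv i).1)
  · rw [Finset.mul_sum]
    refine Finset.sum_le_sum fun i _ => ?_
    rw [mul_left_comm]
    exact mul_le_mul_of_nonneg_right (hle i) (hterm i)

theorem finite_weakEigenvalues_le (hD : D.IsSymm) (hB : B.IsSymm) (hpos : ∀ v ≠ 0, 0 < B v v)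
    (hRellich : ∀ ε > 0, ∃ (ι : Type) (_ : Fintype ι) (φ : V →ₗ[ℝ] ι → ℝ),
      ∀ v, φ v = 0 → B v v ≤ ε * D v v) (Lam : ℝ) :
    {lam | lam ≤ Lam ∧ ∃ v, IsWeakEigenvector D B lam v}.Finite := by
  by_contra hinf
  obtain ⟨ι, _, φ, hφ⟩ := hRellich (1 / (|Lam| + 1)) (by positivity)
  obtain ⟨t, hts, htcard⟩ := Set.Infinite.exists_subset_card_eq hinf (Fintype.card ι + 1)
  choose hle v hv using fun i : t => hts i.2
  have horth (i j : t) (hij : i ≠ j) : B (v i) (v j) = 0 :=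
    (hv i).orthogonal hD hB (hv j) (Subtype.coe_injective.ne hij)
  obtain ⟨c, hcker, hc⟩ := Submodule.exists_mem_ne_zero_of_ne_bot
    (LinearMap.ker_ne_bot_of_finrank_lt (f := φ ∘ₗ Fintype.linearCombination ℝ v)
      (by simp [htcard]))
  rw [LinearMap.mem_ker, LinearMap.comp_apply, Fintype.linearCombination_apply] at hcker
  obtain ⟨hmass, henergy⟩ := rayleigh_sum_le hpos hv hle horth hc
  set x := ∑ i, c i • v i
  have hcontra : B x x < B x x :=
    calc B x x ≤ 1 / (|Lam| + 1) * D x x := hφ x hcker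
      _ ≤ 1 / (|Lam| + 1) * (|Lam| * B x x) := by
          gcongr
          exact henergy.trans (mul_le_mul_of_nonneg_right (le_abs_self _) hmass.le)
      _ < B x x := by
          rw [one_div, inv_mul_lt_iff₀ (by positivity)]
          linarith
  exact hcontra.false

end Rayleigh

theorem contDiff_pderiv {f : ℝ × ℝ → ℝ} (hf : ContDiff ℝ ∞ f) (i : Fin 2) :
    ContDiff ℝ ∞ (pderiv i f) :=
  (hf.fderiv_right (by simp)).clm_apply contDiff_const

theorem pderiv_mul {f g : ℝ × ℝ → ℝ} {q : ℝ × ℝ} (hf : DifferentiableAt ℝ f q)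
    (hg : DifferentiableAt ℝ g q) (i : Fin 2) :
    pderiv i (fun z => f z * g z) q = f q * pderiv i g q + pderiv i f q * g q := by
  rw [pderiv, fderiv_fun_mul hf hg]
  simp only [pderiv, add_apply, smul_apply, smul_eq_mul, mul_comm (g q)]

theorem pderiv_periodic {f : ℝ × ℝ → ℝ} {v : ℝ × ℝ} (hf : f.Periodic v) (i : Fin 2) :
    (pderiv i f).Periodic v := fun q => by
  rw [pderiv, pderiv, ← fderiv_comp_add_right]
  simp only [hf _]

section RectangleIntegral

variable {f : ℝ × ℝ → ℝ} {L H : ℝ}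

theorem setIntegral_pderiv_zero_of_periodic (hf : ContDiff ℝ 1 f) (hL : 0 ≤ L) (hH : 0 ≤ H)
    (hper : f.Periodic (L, 0)) : ∫ z in Set.Icc 0 (L, H), pderiv 0 f z = 0 := by
  have hcont := continuous_pderiv hf 0
  have hinner (y : ℝ) : ∫ x in (0 : ℝ)..L, pderiv 0 f (x, y) = 0 := by
    rw [intervalIntegral.integral_eq_sub_of_hasDerivAt (f := fun x => f (x, y))
      (fun x _ => hasDerivAt_fst (q := (x, y)) (hf.differentiable one_ne_zero _))
      (Continuous.intervalIntegrable (by fun_prop) _ _), sub_eq_zero]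
    simpa using hper (0, y)
  rw [setIntegral_Icc_prod_swap hcont (show (0 : ℝ × ℝ) ≤ (L, H) from ⟨hL, hH⟩)]
  simp only [Prod.fst_zero, hinner, intervalIntegral.integral_zero]

theorem setIntegral_pderiv_one_of_periodic (hf : ContDiff ℝ 1 f) (hL : 0 ≤ L) (hH : 0 ≤ H)
    (hper : f.Periodic (0, H)) : ∫ z in Set.Icc 0 (L, H), pderiv 1 f z = 0 := by
  have hcont := continuous_pderiv hf 1
  have hinner (x : ℝ) : ∫ y in (0 : ℝ)..H, pderiv 1 f (x, y) = 0 := by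
    rw [intervalIntegral.integral_eq_sub_of_hasDerivAt (f := fun y => f (x, y))
      (fun y _ => hasDerivAt_snd (q := (x, y)) (hf.differentiable one_ne_zero _))
      (Continuous.intervalIntegrable (by fun_prop) _ _), sub_eq_zero]
    simpa using hper (x, 0)
  rw [setIntegral_Icc_prod hcont (show (0 : ℝ × ℝ) ≤ (L, H) from ⟨hL, hH⟩)]
  simp only [Prod.snd_zero, hinner, intervalIntegral.integral_zero]

theorem eqOn_zero_of_setIntegral_eq_zero (hf : Continuous f) (hnonneg : 0 ≤ f) (hL : 0 < L)
    (hH : 0 < H) (hint : ∫ z in Set.Icc 0 (L, H), f z = 0) :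
    Set.EqOn f 0 (Set.Icc 0 (L, H)) := by
  have hae : f =ᵐ[volume.restrict (Set.Icc 0 (L, H))] 0 :=
    (setIntegral_eq_zero_iff_of_nonneg_ae (.of_forall hnonneg) hf.integrableOn_Icc).1 hint
  refine Measure.eqOn_of_ae_eq hae hf.continuousOn continuousOn_const ?_
  rw [Set.Icc_prod_eq, interior_prod_eq, closure_prod_eq, interior_Icc, interior_Icc,
    Prod.fst_zero, Prod.snd_zero, closure_Ioo hL.ne, closure_Ioo hH.ne]

theorem eq_zero_of_eqOn_zero_of_periodic (hL : 0 < L) (hH : 0 < H) (hperL : f.Periodic (L, 0))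
    (hperH : f.Periodic (0, H)) (hf : Set.EqOn f 0 (Set.Icc 0 (L, H))) : f = 0 := by
  funext q
  obtain ⟨j, hj, -⟩ := existsUnique_add_zsmul_mem_Ico hL q.1 0
  obtain ⟨k, hk, -⟩ := existsUnique_add_zsmul_mem_Ico hH q.2 0
  rw [zero_add] at hj hk
  have hshift : f q = f (q.1 + j • L, q.2 + k • H) := by
    rw [← hperL.zsmul j q, ← hperH.zsmul k]
    exact congrArg f (Prod.ext (by simp) (by simp))
  rw [hshift]
  exact hf ⟨⟨hj.1, hk.1⟩, hj.2.le, hk.2.le⟩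

end RectangleIntegral

section TorusForms

variable {L H : ℝ}

/-- The smooth functions on the torus `ℝ² / (Lℤ × Hℤ)`, as doubly periodic functions. -/
def torusFunctions (L H : ℝ) : Submodule ℝ C(ℝ × ℝ, ℝ) where
  carrier := {f | ContDiff ℝ ∞ f ∧ Function.Periodic f (L, 0) ∧ Function.Periodic f (0, H)}
  add_mem' hf hg := ⟨hf.1.add hg.1, hf.2.1.add hg.2.1, hf.2.2.add hg.2.2⟩
  zero_mem' := ⟨contDiff_const, fun _ => rfl, fun _ => rfl⟩
  smul_mem' c _ hf := ⟨contDiff_const.smul hf.1, hf.2.1.smul c, hf.2.2.smul c⟩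

/-- The partial derivative as a linear map on the smooth functions of a torus. -/
noncomputable def torusPderiv (L H : ℝ) (i : Fin 2) : torusFunctions L H →ₗ[ℝ] C(ℝ × ℝ, ℝ) where
  toFun f := ⟨pderiv i f.1, (contDiff_pderiv f.2.1 i).continuous⟩
  map_add' f g := ContinuousMap.ext fun q => by
    have hf : DifferentiableAt ℝ f.1 q := f.2.1.differentiable (by simp) q
    have hg : DifferentiableAt ℝ g.1 q := g.2.1.differentiable (by simp) q
    exact congrArg (· (coordVec i)) (fderiv_add hf hg)
  map_smul' c f := ContinuousMap.ext fun q => by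
    have hf : DifferentiableAt ℝ f.1 q := f.2.1.differentiable (by simp) q
    exact congrArg (· (coordVec i)) (fderiv_const_smul hf c)

/-- Integration over the rectangle `[p, q]` as a linear functional. -/
noncomputable def rectIntegral (p q : ℝ × ℝ) : C(ℝ × ℝ, ℝ) →ₗ[ℝ] ℝ where
  toFun f := ∫ z in Set.Icc p q, f z
  map_add' f g := integral_add f.continuous.integrableOn_Icc g.continuous.integrableOn_Icc
  map_smul' c f := integral_const_mul c f

/-- The form `∫ ρ f g` over the rectangle `[0, L] × [0, H]`. -/
noncomputable def rectForm (ρ : C(ℝ × ℝ, ℝ)) (L H : ℝ) : LinearMap.BilinForm ℝ C(ℝ × ℝ, ℝ) :=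
  (LinearMap.mul ℝ C(ℝ × ℝ, ℝ)).compr₂ (rectIntegral 0 (L, H) ∘ₗ LinearMap.mulLeft ℝ ρ)

theorem rectForm_apply (ρ : C(ℝ × ℝ, ℝ)) (L H : ℝ) (f g : C(ℝ × ℝ, ℝ)) :
    rectForm ρ L H f g = ∫ z in Set.Icc 0 (L, H), ρ z * (f z * g z) := rfl

theorem isSymm_rectForm (ρ : C(ℝ × ℝ, ℝ)) (L H : ℝ) : (rectForm ρ L H).IsSymm :=
  ⟨fun f g => by simp only [rectForm_apply, mul_comm (f _)]⟩

/-- The mass form `∫ ρ f g` on the smooth functions of a torus. -/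
noncomputable def massForm (ρ : C(ℝ × ℝ, ℝ)) (L H : ℝ) :
    LinearMap.BilinForm ℝ (torusFunctions L H) :=
  (rectForm ρ L H).compl₁₂ (torusFunctions L H).subtype (torusFunctions L H).subtype

/-- The Dirichlet form `∫ ⟨∇f, ∇g⟩` on the smooth functions of a torus. -/
noncomputable def dirichletForm (L H : ℝ) : LinearMap.BilinForm ℝ (torusFunctions L H) :=
  ∑ i, (rectForm 1 L H).compl₁₂ (torusPderiv L H i) (torusPderiv L H i)

theorem dirichletForm_apply (f g : torusFunctions L H) :
    dirichletForm L H f g = ∫ z in Set.Icc 0 (L, H),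
      (pderiv 0 f.1 z * pderiv 0 g.1 z + pderiv 1 f.1 z * pderiv 1 g.1 z) := by
  have hf (i : Fin 2) := (contDiff_pderiv f.2.1 i).continuous
  have hg (i : Fin 2) := (contDiff_pderiv g.2.1 i).continuous
  have happly : dirichletForm L H f g =
      (∫ z in Set.Icc 0 (L, H), 1 * (pderiv 0 f.1 z * pderiv 0 g.1 z)) +
        ∫ z in Set.Icc 0 (L, H), 1 * (pderiv 1 f.1 z * pderiv 1 g.1 z) := by
    rw [dirichletForm, Fin.sum_univ_two]
    rfl
  simp only [happly, one_mul]
  exact (integral_add ((hf 0).mul (hg 0)).integrableOn_Icc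
    ((hf 1).mul (hg 1)).integrableOn_Icc).symm

theorem dirichletForm_eq_of_pde (hL : 0 ≤ L) (hH : 0 ≤ H) {ρ : C(ℝ × ℝ, ℝ)} {lam : ℝ}
    {f : torusFunctions L H}
    (hf : ∀ q, pderiv 0 (pderiv 0 f.1) q + pderiv 1 (pderiv 1 f.1) q + lam * ρ q * f.1 q = 0)
    (g : torusFunctions L H) : dirichletForm L H f g = lam * massForm ρ L H f g := by
  have hsmooth (i : Fin 2) : ContDiff ℝ ∞ fun z => g.1 z * pderiv i f.1 z :=
    g.2.1.mul (contDiff_pderiv f.2.1 i)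
  have hcont (i : Fin 2) := (contDiff_pderiv (hsmooth i) i).continuous
  have hpt (q : ℝ × ℝ) : pderiv 0 f.1 q * pderiv 0 g.1 q + pderiv 1 f.1 q * pderiv 1 g.1 q =
      (pderiv 0 (fun z => g.1 z * pderiv 0 f.1 z) q +
        pderiv 1 (fun z => g.1 z * pderiv 1 f.1 z) q) + lam * (ρ q * (f.1 q * g.1 q)) := by
    have hdiff (i : Fin 2) := (contDiff_pderiv f.2.1 i).differentiable (by simp) q
    rw [pderiv_mul (g.2.1.differentiable (by simp) q) (hdiff 0),
      pderiv_mul (g.2.1.differentiable (by simp) q) (hdiff 1)]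
    linear_combination -g.1 q * hf q
  have hdiv : ∫ z in Set.Icc 0 (L, H), (pderiv 0 (fun z => g.1 z * pderiv 0 f.1 z) z +
      pderiv 1 (fun z => g.1 z * pderiv 1 f.1 z) z) = 0 := by
    rw [integral_add (hcont 0).integrableOn_Icc (hcont 1).integrableOn_Icc,
      setIntegral_pderiv_zero_of_periodic ((hsmooth 0).of_le (by simp)) hL hH
        (g.2.2.1.mul (pderiv_periodic f.2.2.1 0)),
      setIntegral_pderiv_one_of_periodic ((hsmooth 1).of_le (by simp)) hL hH
        (g.2.2.2.mul (pderiv_periodic f.2.2.2 1)), add_zero]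
  simp only [dirichletForm_apply, hpt]
  rw [integral_add ((hcont 0).fun_add (hcont 1)).integrableOn_Icc
    (Continuous.integrableOn_Icc (by fun_prop)), hdiv, zero_add, integral_const_mul]
  rfl

theorem massForm_self_pos (hL : 0 < L) (hH : 0 < H) {ρ : C(ℝ × ℝ, ℝ)} (hρ : ∀ q, 0 < ρ q)
    {f : torusFunctions L H} (hf : f ≠ 0) : 0 < massForm ρ L H f f := by
  have hnonneg : 0 ≤ fun z => ρ z * (f.1 z * f.1 z) :=
    fun z => mul_nonneg (hρ z).le (mul_self_nonneg _)
  refine lt_of_le_of_ne (integral_nonneg hnonneg) fun hzero => hf ?_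
  have heqOn := eqOn_zero_of_setIntegral_eq_zero (by fun_prop) hnonneg hL hH hzero.symm
  refine Subtype.ext (DFunLike.coe_injective
    (eq_zero_of_eqOn_zero_of_periodic hL hH f.2.2.1 f.2.2.2 fun z hz => ?_))
  exact mul_self_eq_zero.1 ((mul_eq_zero.1 (heqOn hz)).resolve_left (hρ z).ne')

theorem exists_massForm_self_le_mul_dirichletForm (hL : 0 < L) (hH : 0 < H) {ρ : C(ℝ × ℝ, ℝ)}
    (hρ : ∀ q, 0 < ρ q) {ε : ℝ} (hε : 0 < ε) :
    ∃ (ι : Type) (_ : Fintype ι) (φ : torusFunctions L H →ₗ[ℝ] ι → ℝ),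
      ∀ f, φ f = 0 → massForm ρ L H f f ≤ ε * dirichletForm L H f f := by
  obtain ⟨M, hM⟩ := (isCompact_Icc (a := (0 : ℝ × ℝ)) (b := (L, H))).bddAbove_image
    ρ.continuous.continuousOn
  have hM0 : 0 < M := (hρ 0).trans_le (hM (Set.mem_image_of_mem ρ ⟨le_rfl, hL.le, hH.le⟩))
  obtain ⟨N, hN⟩ := exists_nat_gt (max 1 (M * (L ^ 2 + H ^ 2) / ε))
  have hN1 : (1 : ℝ) ≤ N := (le_max_left _ _).trans hN.le
  have hNε : M * ((L ^ 2 + H ^ 2) / N ^ 2) ≤ ε := by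
    rw [← mul_div_assoc, div_le_iff₀ (by positivity), mul_comm ε, ← div_le_iff₀ hε]
    exact ((le_max_right _ _).trans hN.le).trans (le_self_pow₀ hN1 two_ne_zero)
  refine ⟨Fin N × Fin N, inferInstance, LinearMap.pi fun k =>
    rectIntegral (k.1 * (L / N), k.2 * (H / N))
      ((k.1 + 1 : ℕ) * (L / N), (k.2 + 1 : ℕ) * (H / N)) ∘ₗ (torusFunctions L H).subtype,
    fun f hφ => ?_⟩
  have hcell : ∀ i < N, ∀ j < N, ∫ z in gridCell L H N i j, f.1 z = 0 := fun i hi j hj =>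
    congrFun hφ (⟨i, hi⟩, ⟨j, hj⟩)
  have hpoincare := setIntegral_sq_le_of_gridCell (f.2.1.of_le (by simp)) hL hH
    (Nat.cast_pos.1 (zero_lt_one.trans_le hN1)).ne' hcell
  have hnonneg : 0 ≤ dirichletForm L H f f := by
    rw [dirichletForm_apply]
    exact integral_nonneg fun z => add_nonneg (mul_self_nonneg _) (mul_self_nonneg _)
  calc massForm ρ L H f f ≤ ∫ z in Set.Icc 0 (L, H), M * f.1 z ^ 2 :=
        setIntegral_mono_on (Continuous.integrableOn_Icc (by fun_prop))
          (Continuous.integrableOn_Icc (by fun_prop)) measurableSet_Icc fun z hz => by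
            rw [sq]
            exact mul_le_mul_of_nonneg_right (hM (Set.mem_image_of_mem ρ hz)) (mul_self_nonneg _)
    _ ≤ M * ((L ^ 2 + H ^ 2) / N ^ 2 * dirichletForm L H f f) := by
        rw [integral_const_mul, dirichletForm_apply]
        simp only [← sq]
        gcongr
    _ ≤ ε * dirichletForm L H f f := by
        rw [← mul_assoc]
        gcongr

theorem finite_torus_eigenvalues_le (hL : 0 < L) (hH : 0 < H) {ρ : ℝ × ℝ → ℝ} (hcont : Continuous ρ)
    (hρ : ∀ q, 0 < ρ q) (Lam : ℝ) :
    {lam | lam ≤ Lam ∧ ∃ F : ℝ × ℝ → ℝ, F ≠ 0 ∧ ContDiff ℝ ∞ F ∧ F.Periodic (L, 0) ∧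
      F.Periodic (0, H) ∧ ∀ q, pderiv 0 (pderiv 0 F) q + pderiv 1 (pderiv 1 F) q +
        lam * ρ q * F q = 0}.Finite := by
  let ρ' : C(ℝ × ℝ, ℝ) := ⟨ρ, hcont⟩
  have hB : (massForm ρ' L H).IsSymm := ⟨fun f g => (isSymm_rectForm ρ' L H).eq f.1 g.1⟩
  have hD : (dirichletForm L H).IsSymm :=
    ⟨fun f g => by simp only [dirichletForm_apply, mul_comm (pderiv _ f.1 _)]⟩
  refine (finite_weakEigenvalues_le hD hB (fun f => massForm_self_pos hL hH hρ)
    (fun ε => exists_massForm_self_le_mul_dirichletForm hL hH hρ) Lam).subset ?_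
  rintro lam ⟨hle, F, hF0, hF, hperL, hperH, hpde⟩
  let f : torusFunctions L H := ⟨⟨F, hF.continuous⟩, hF, hperL, hperH⟩
  refine ⟨hle, f, fun hf => hF0 ?_, dirichletForm_eq_of_pde (f := f) hL.le hH.le hpde⟩
  exact congrArg (fun f : torusFunctions L H => ⇑f.1) hf

end TorusForms

/-! ### Hill equations and the Prüfer angle -/

section GlobalSolution

variable {E : Type*} [NormedAddCommGroup E] [NormedSpace ℝ E] {f : ℝ → E → E} {K C : NNReal}

theorem exists_hasDerivAt_of_lipschitz_of_mem_Ioo [CompleteSpace E]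
    (hlip : ∀ t, LipschitzWith K (f t)) (hcont : ∀ x, Continuous fun t => f t x)
    (hC : ∀ t x, ‖f t x‖ ≤ C) (x₀ : E) (N : ℕ) :
    ∃ α : ℝ → E, α 0 = x₀ ∧ ∀ t ∈ Set.Ioo (-(N : ℝ)) N, HasDerivAt α (f t (α t)) t := by
  have h0 : (0 : ℝ) ∈ Set.Icc (-(N : ℝ)) N := by simp
  have hP : IsPicardLindelof f (⟨0, h0⟩ : Set.Icc (-(N : ℝ)) N) x₀ (C * N) 0 C K :=
    { lipschitzOnWith := fun t _ => (hlip t).lipschitzOnWith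
      continuousOn := fun x _ => (hcont x).continuousOn
      norm_le := fun t _ x _ => hC t x
      mul_max_le := by simp }
  obtain ⟨α, hα0, hα⟩ := hP.exists_eq_forall_mem_Icc_hasDerivWithinAt₀
  exact ⟨α, hα0, fun t ht =>
    (hα t (Set.Ioo_subset_Icc_self ht)).hasDerivAt (Icc_mem_nhds ht.1 ht.2)⟩

theorem eqOn_Ioo_of_hasDerivAt_of_lipschitz (hlip : ∀ t, LipschitzWith K (f t)) {α β : ℝ → E}
    (h0 : α 0 = β 0) {a b : ℝ} (hab : a ≤ b)
    (hα : ∀ t ∈ Set.Ioo (-a) a, HasDerivAt α (f t (α t)) t)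
    (hβ : ∀ t ∈ Set.Ioo (-b) b, HasDerivAt β (f t (β t)) t) : Set.EqOn α β (Set.Ioo (-a) a) :=
  fun t ht => ODE_solution_unique_of_mem_Ioo (v := f) (s := fun _ => Set.univ) (t₀ := 0)
    (fun t _ => (hlip t).lipschitzOnWith) (by constructor <;> linarith [ht.1, ht.2])
    (fun t ht => ⟨hα t ht, trivial⟩)
    (fun t ht => ⟨hβ t (Set.Ioo_subset_Ioo (neg_le_neg hab) hab ht), trivial⟩) h0 ht

theorem exists_forall_hasDerivAt_of_lipschitz [CompleteSpace E]
    (hlip : ∀ t, LipschitzWith K (f t)) (hcont : ∀ x, Continuous fun t => f t x)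
    (hC : ∀ t x, ‖f t x‖ ≤ C) (x₀ : E) :
    ∃ α : ℝ → E, α 0 = x₀ ∧ ∀ t, HasDerivAt α (f t (α t)) t := by
  choose α hα0 hα using exists_hasDerivAt_of_lipschitz_of_mem_Ioo hlip hcont hC x₀
  have hagree (N N' : ℕ) (hle : N ≤ N') : Set.EqOn (α N) (α N') (Set.Ioo (-(N : ℝ)) N) :=
    eqOn_Ioo_of_hasDerivAt_of_lipschitz hlip ((hα0 N).trans (hα0 N').symm) (Nat.cast_le.2 hle)
      (hα N) (hα N')
  have hmem (t : ℝ) : t ∈ Set.Ioo (-((⌈|t|⌉₊ + 1 : ℕ) : ℝ)) (⌈|t|⌉₊ + 1 : ℕ) := by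
    rw [Set.mem_Ioo, ← abs_lt, Nat.cast_succ]
    exact (Nat.le_ceil _).trans_lt (lt_add_one _)
  refine ⟨fun t => α (⌈|t|⌉₊ + 1) t, hα0 _, fun t => ?_⟩
  refine (hα _ t (hmem t)).congr_of_eventuallyEq ?_
  filter_upwards [Ioo_mem_nhds (hmem t).1 (hmem t).2] with s hs
  rcases le_total (⌈|s|⌉₊ + 1) (⌈|t|⌉₊ + 1) with hle | hle
  · exact hagree _ _ hle (hmem s)
  · exact (hagree _ _ hle hs).symm

end GlobalSolution

section Hill

variable {q u w u₁ w₁ u₂ w₂ : ℝ → ℝ}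

/-- `u` is a solution of Hill's equation `u'' + q u = 0` with derivative `w`. -/
structure IsHillSolution (q u w : ℝ → ℝ) : Prop where
  hasDerivAt (x : ℝ) : HasDerivAt u (w x) x
  hasDerivAt_deriv (x : ℝ) : HasDerivAt w (-q x * u x) x

theorem IsHillSolution.contDiff (h : IsHillSolution q u w) (hq : ContDiff ℝ ∞ q) :
    ContDiff ℝ ∞ u := by
  have hpair (k : ℕ) : ContDiff ℝ k u ∧ ContDiff ℝ k w := by
    induction k with
    | zero =>
      exact ⟨contDiff_zero.2 (continuous_iff_continuousAt.2 fun x => (h.1 x).continuousAt),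
        contDiff_zero.2 (continuous_iff_continuousAt.2 fun x => (h.2 x).continuousAt)⟩
    | succ k ih =>
      have hu : deriv u = w := funext fun x => (h.1 x).deriv
      have hw : deriv w = fun x => -q x * u x := funext fun x => (h.2 x).deriv
      rw [Nat.cast_succ, contDiff_succ_iff_deriv, contDiff_succ_iff_deriv, hu, hw]
      exact ⟨⟨fun x => (h.1 x).differentiableAt, by simp, ih.2⟩,
        ⟨fun x => (h.2 x).differentiableAt, by simp, (hq.of_le (mod_cast le_top)).neg.mul ih.1⟩⟩
  exact contDiff_infty.2 fun k => (hpair k).1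

theorem IsHillSolution.neg (h : IsHillSolution q u w) : IsHillSolution q (-u) (-w) :=
  ⟨fun x => (h.1 x).neg, fun x => (h.2 x).neg.congr_deriv (by simp)⟩

theorem IsHillSolution.comp_sub_left (h : IsHillSolution q u w) (c : ℝ) :
    IsHillSolution (fun x => q (c - x)) (fun x => u (c - x)) fun x => -w (c - x) :=
  ⟨fun x => ((h.1 _).comp_const_sub c x), fun x =>
    ((h.2 _).comp_const_sub c x).neg.congr_deriv (neg_neg _)⟩

theorem IsHillSolution.unique {C : NNReal} (hq : ∀ x, |q x| ≤ C) (h₁ : IsHillSolution q u₁ w₁)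
    (h₂ : IsHillSolution q u₂ w₂) {x₀ : ℝ} (hu : u₁ x₀ = u₂ x₀) (hw : w₁ x₀ = w₂ x₀) :
    u₁ = u₂ := by
  have hlip (t : ℝ) : LipschitzWith (max 1 C) fun z : ℝ × ℝ => (z.2, -q t * z.1) := by
    refine LipschitzWith.prod_snd.prodMk (LipschitzWith.of_dist_le_mul fun a b => ?_)
    rw [Real.dist_eq, ← mul_sub, abs_mul, abs_neg, Prod.dist_eq]
    exact mul_le_mul (hq t) (le_max_left _ _) (abs_nonneg _) C.2
  have hpair := ODE_solution_unique_univ (f := fun x => (u₁ x, w₁ x)) (g := fun x => (u₂ x, w₂ x))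
    (v := fun t z => (z.2, -q t * z.1)) (s := fun _ => Set.univ) (t₀ := x₀)
    (fun t => (hlip t).lipschitzOnWith) (fun t => ⟨(h₁.1 t).prodMk (h₁.2 t), trivial⟩)
    (fun t => ⟨(h₂.1 t).prodMk (h₂.2 t), trivial⟩) (Prod.ext hu hw)
  exact funext fun x => congrArg Prod.fst (congrFun hpair x)

theorem IsHillSolution.even {C : NNReal} (hq : ∀ x, |q x| ≤ C) (heven : q.Even)
    (h : IsHillSolution q u w) (hw : w 0 = 0) : u.Even := by
  have hrefl := h.comp_sub_left 0
  simp only [zero_sub, heven _] at hrefl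
  exact congrFun (hrefl.unique hq h (x₀ := 0) (by simp) (by simp [hw]))

theorem IsHillSolution.neg_comp_two_mul_sub {C : NNReal} (hq : ∀ x, |q x| ≤ C) {A : ℝ}
    (hsymm : ∀ x, q (2 * A - x) = q x) (h : IsHillSolution q u w) (hu : u A = 0) (x : ℝ) :
    -u (2 * A - x) = u x := by
  have hrefl := (h.comp_sub_left (2 * A)).neg
  simp only [hsymm] at hrefl
  have hA : 2 * A - A = A := by ring
  exact congrFun (hrefl.unique hq h (x₀ := A) (by simp [hA, hu]) (by simp [hA])) x

end Hill

section Prufer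

variable {q q₁ q₂ k ρ v w θ θ₁ θ₂ : ℝ → ℝ} {M : NNReal} {A sig : ℝ}

/-- The right-hand side of the Prüfer equation `θ' = sin² θ + q cos² θ`, which is obtained from
`u'' + q u = 0` by writing `(u, -u') = R (cos θ, sin θ)`. -/
noncomputable def prufer (q : ℝ → ℝ) (x θ : ℝ) : ℝ :=
  Real.sin θ ^ 2 + q x * Real.cos θ ^ 2

/-- `θ` is the Prüfer angle of the solution of `u'' + q u = 0` with `u 0 = 1` and `u' 0 = 0`. -/
structure IsPruferAngle (q θ : ℝ → ℝ) : Prop where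
  zero : θ 0 = 0
  hasDerivAt (x : ℝ) : HasDerivAt θ (prufer q x (θ x)) x

theorem abs_prufer_le (hq : ∀ x, |q x| ≤ M) (x θ : ℝ) :
    |prufer q x θ| ≤ (1 + M : NNReal) := by
  rw [NNReal.coe_add, NNReal.coe_one]
  refine (abs_add_le _ _).trans (add_le_add ?_ ?_)
  · rw [abs_sq]
    exact Real.sin_sq_le_one θ
  · rw [abs_mul, abs_sq]
    exact (mul_le_of_le_one_right (abs_nonneg _) (Real.cos_sq_le_one θ)).trans (hq x)

theorem lipschitzWith_prufer (hq : ∀ x, |q x| ≤ M) (x : ℝ) :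
    LipschitzWith (1 + M) (prufer q x) := by
  refine LipschitzWith.of_dist_le_mul fun a b => ?_
  have hsub : prufer q x a - prufer q x b =
      (1 - q x) * (Real.sin (a + b) * Real.sin (a - b)) := by
    rw [prufer, prufer, Real.sin_sub, Real.sin_add, Real.cos_sq', Real.cos_sq']
    linear_combination (-(1 - q x)) * (Real.sin a ^ 2 * Real.cos_sq' b -
      Real.sin b ^ 2 * Real.cos_sq' a)
  rw [Real.dist_eq, Real.dist_eq, hsub, abs_mul, abs_mul, NNReal.coe_add, NNReal.coe_one]
  gcongr
  · exact (abs_sub _ _).trans (by simpa using hq x)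
  · exact (mul_le_of_le_one_left (abs_nonneg _) (Real.abs_sin_le_one _)).trans Real.abs_sin_le_abs

theorem exists_isPruferAngle (hcont : Continuous q) (hq : ∀ x, |q x| ≤ M) :
    ∃ θ, IsPruferAngle q θ := by
  obtain ⟨θ, h0, hθ⟩ := exists_forall_hasDerivAt_of_lipschitz (lipschitzWith_prufer hq)
    (fun θ => by unfold prufer; fun_prop) (abs_prufer_le hq) 0
  exact ⟨θ, h0, hθ⟩

theorem IsPruferAngle.dist_le (hq : ∀ x, |q₂ x| ≤ M) (h₁ : IsPruferAngle q₁ θ₁)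
    (h₂ : IsPruferAngle q₂ θ₂) {δ : ℝ} (hδ : ∀ x, |q₁ x - q₂ x| ≤ δ) (hA : 0 ≤ A) :
    dist (θ₁ A) (θ₂ A) ≤ gronwallBound 0 (1 + M : NNReal) (δ + 0) (A - 0) := by
  refine dist_le_of_approx_trajectories_ODE (v := prufer q₂)
    (fun t => lipschitzWith_prufer hq t)
    (fun t _ => (h₁.2 t).continuousAt.continuousWithinAt)
    (fun t _ => (h₁.2 t).hasDerivWithinAt) (fun t _ => ?_)
    (fun t _ => (h₂.2 t).continuousAt.continuousWithinAt)
    (fun t _ => (h₂.2 t).hasDerivWithinAt) (fun t _ => (dist_self _).le)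
    (by rw [h₁.1, h₂.1, dist_self]) A ⟨hA, le_rfl⟩
  have hsub : prufer q₁ t (θ₁ t) - prufer q₂ t (θ₁ t) =
      (q₁ t - q₂ t) * Real.cos (θ₁ t) ^ 2 := by
    rw [prufer, prufer]
    ring
  rw [Real.dist_eq, hsub, abs_mul, abs_sq]
  exact (mul_le_of_le_one_right (abs_nonneg _) (Real.cos_sq_le_one _)).trans (hδ t)

theorem continuous_pruferAngle (hρ : ∀ x, |ρ x| ≤ M) {θ : ℝ → ℝ → ℝ}
    (hθ : ∀ lam, IsPruferAngle (fun x => lam * ρ x) (θ lam)) (hA : 0 ≤ A) :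
    Continuous fun lam => θ lam A := by
  rw [continuous_iff_continuousAt]
  intro lam
  have hbound (mu : ℝ) : dist (θ mu A) (θ lam A) ≤
      gronwallBound 0 (1 + ‖lam‖₊ * M : NNReal) (|mu - lam| * M + 0) (A - 0) := by
    refine (hθ mu).dist_le (fun x => ?_) (hθ lam) (fun x => ?_) hA
    · rw [abs_mul]
      exact mul_le_mul_of_nonneg_left (hρ x) (abs_nonneg _)
    · rw [← sub_mul, abs_mul]
      exact mul_le_mul_of_nonneg_left (hρ x) (abs_nonneg _)
  have hcont : Continuous fun mu : ℝ =>
      gronwallBound 0 (1 + ‖lam‖₊ * M : NNReal) (|mu - lam| * M + 0) (A - 0) :=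
    (gronwallBound_continuous_ε 0 _ (A - 0)).comp (by fun_prop)
  refine tendsto_iff_dist_tendsto_zero.2 (squeeze_zero (fun _ => dist_nonneg) hbound ?_)
  simpa [gronwallBound_ε0_δ0] using hcont.tendsto lam

theorem IsPruferAngle.eq_zero (h : IsPruferAngle (fun _ => 0) θ) : θ = 0 :=
  ODE_solution_unique_univ (v := prufer fun _ => 0) (s := fun _ => Set.univ) (t₀ := 0)
    (K := 1 + 0) (fun t => (lipschitzWith_prufer (by simp) t).lipschitzOnWith)
    (fun t => ⟨h.2 t, trivial⟩)
    (fun t => ⟨by simp [prufer], trivial⟩) h.1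

theorem IsPruferAngle.strictMono (h : IsPruferAngle q θ) (hq : ∀ x, 0 < q x) : StrictMono θ := by
  refine strictMono_of_hasDerivAt_pos h.2 fun x => ?_
  have hsum := Real.sin_sq_add_cos_sq (θ x)
  rcases (sq_nonneg (Real.cos (θ x))).eq_or_lt with hcos | hcos
  · rw [prufer, ← hcos, mul_zero, add_zero]
    linarith
  · exact add_pos_of_nonneg_of_pos (sq_nonneg _) (mul_pos (hq x) hcos)

theorem IsPruferAngle.exists_isHillSolution (h : IsPruferAngle q θ) (hq : Continuous q) :
    ∃ R : ℝ → ℝ, (∀ x, 0 < R x) ∧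
      IsHillSolution q (fun x => R x * Real.cos (θ x)) fun x => -(R x * Real.sin (θ x)) := by
  have hθ : Continuous θ := continuous_iff_continuousAt.2 fun x => (h.2 x).continuousAt
  let g : ℝ → ℝ := fun x => Real.sin (θ x) * Real.cos (θ x) * (q x - 1)
  have hg : Continuous g := by fun_prop
  have hR (x : ℝ) : HasDerivAt (fun x => Real.exp (∫ t in (0 : ℝ)..x, g t))
      (Real.exp (∫ t in (0 : ℝ)..x, g t) * g x) x :=
    (hg.integral_hasStrictDerivAt 0 x).hasDerivAt.exp
  refine ⟨fun x => Real.exp (∫ t in (0 : ℝ)..x, g t), fun x => Real.exp_pos _, fun x => ?_,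
    fun x => ?_⟩
  · refine ((hR x).mul (h.2 x).cos).congr_deriv ?_
    simp only [g, prufer]
    linear_combination (-(Real.exp (∫ t in (0 : ℝ)..x, g t) * Real.sin (θ x))) *
      Real.sin_sq_add_cos_sq (θ x)
  · refine ((hR x).mul (h.2 x).sin).neg.congr_deriv ?_
    simp only [g, prufer]
    linear_combination (-(Real.exp (∫ t in (0 : ℝ)..x, g t) * Real.cos (θ x)) * q x) *
      Real.sin_sq_add_cos_sq (θ x)

theorem nonpos_of_hasDerivAt_of_nonneg_left {f : ℝ → ℝ} {f' a b : ℝ} (hab : a < b)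
    (hf : HasDerivAt f f' b) (hb : f b = 0) (hpos : ∀ x ∈ Set.Ioo a b, 0 ≤ f x) : f' ≤ 0 := by
  have hslope := (hasDerivWithinAt_iff_tendsto_slope' (Set.self_notMem_Iio (a := b))).1
    (hf.hasDerivWithinAt (s := Set.Iio b))
  refine le_of_tendsto hslope ?_
  filter_upwards [Ioo_mem_nhdsLT hab] with x hx
  rw [slope_def_field, hb, sub_zero]
  exact div_nonpos_of_nonneg_of_nonpos (hpos x hx) (sub_nonpos.2 hx.2.le)

theorem IsPruferAngle.pi_div_two_lt_of_comparison (h : IsPruferAngle q θ) (hcont : Continuous q)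
    (hq : ∀ x, 0 < q x) (hA : 0 < A) (hv : IsHillSolution k v w) (hw0 : w 0 = 0) (hvA : v A = 0)
    (hpos : ∀ x ∈ Set.Ioo 0 A, 0 < v x) (hk : ∀ x ∈ Set.Ioo 0 A, k x < q x) :
    Real.pi / 2 < θ A := by
  by_contra! hle
  obtain ⟨R, hR, hu⟩ := h.exists_isHillSolution hcont
  have hmono := h.strictMono hq
  have hθ_pos {x : ℝ} (hx : 0 < x) : -(Real.pi / 2) < θ x := by
    linarith [Real.pi_pos, h.1, hmono hx]
  have hupos (x : ℝ) (hx : x ∈ Set.Ioo 0 A) : 0 < R x * Real.cos (θ x) :=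
    mul_pos (hR x) (Real.cos_pos_of_mem_Ioo ⟨hθ_pos hx.1, (hmono hx.2).trans_le hle⟩)
  have huA : 0 ≤ R A * Real.cos (θ A) :=
    mul_nonneg (hR A).le (Real.cos_nonneg_of_mem_Icc ⟨(hθ_pos hA).le, hle⟩)
  let W : ℝ → ℝ := fun x => -(R x * Real.sin (θ x)) * v x - R x * Real.cos (θ x) * w x
  have hW (x : ℝ) : HasDerivAt W (-((q x - k x) * (R x * Real.cos (θ x) * v x))) x :=
    (((hu.2 x).mul (hv.1 x)).sub ((hu.1 x).mul (hv.2 x))).congr_deriv (by ring)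
  have hanti : StrictAntiOn W (Set.Icc 0 A) := by
    refine strictAntiOn_of_deriv_neg (convex_Icc 0 A)
      (fun x _ => (hW x).continuousAt.continuousWithinAt) fun x hx => ?_
    rw [interior_Icc] at hx
    rw [(hW x).deriv]
    exact neg_neg_of_pos (mul_pos (sub_pos.2 (hk x hx)) (mul_pos (hupos x hx) (hpos x hx)))
  have hlt : W A < W 0 := hanti ⟨le_rfl, hA.le⟩ ⟨hA.le, le_rfl⟩ hA
  have hW0 : W 0 = 0 := by simp [W, h.1, hw0]
  have hWA : 0 ≤ W A := by
    simp only [W, hvA, mul_zero, zero_sub, neg_nonneg]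
    exact mul_nonpos_of_nonneg_of_nonpos huA
      (nonpos_of_hasDerivAt_of_nonneg_left hA (hv.1 A) hvA fun x hx => (hpos x hx).le)
  linarith

theorem exists_isPruferAngle_eq_pi_div_two (hcont : Continuous ρ) (hρ : ∀ x, |ρ x| ≤ M)
    (hρ_pos : ∀ x, 0 < ρ x) (hsig : 0 < sig) (hA : 0 < A) (hv : IsHillSolution k v w)
    (hw0 : w 0 = 0) (hvA : v A = 0) (hpos : ∀ x ∈ Set.Ioo 0 A, 0 < v x)
    (hk : ∀ x ∈ Set.Ioo 0 A, k x < sig * ρ x) :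
    ∃ lam ∈ Set.Ioo 0 sig, ∃ θ, IsPruferAngle (fun x => lam * ρ x) θ ∧ θ A = Real.pi / 2 := by
  have hexists (lam : ℝ) : ∃ θ, IsPruferAngle (fun x => lam * ρ x) θ :=
    exists_isPruferAngle (M := ‖lam‖₊ * M) (by fun_prop) fun x => by
      rw [abs_mul]
      exact mul_le_mul_of_nonneg_left (hρ x) (abs_nonneg _)
  choose θ hθ using hexists
  have hzero : θ 0 A = 0 := by
    have h0 := hθ 0
    simp only [zero_mul] at h0
    rw [h0.eq_zero, Pi.zero_apply]
  have hlarge : Real.pi / 2 < θ sig A := (hθ sig).pi_div_two_lt_of_comparison (by fun_prop)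
    (fun x => mul_pos hsig (hρ_pos x)) hA hv hw0 hvA hpos hk
  obtain ⟨lam, hlam, hval⟩ := intermediate_value_Ioo hsig.le
    (continuous_pruferAngle hρ hθ hA.le).continuousOn
    (show Real.pi / 2 ∈ Set.Ioo (θ 0 A) (θ sig A) from ⟨hzero.trans_lt Real.pi_div_two_pos, hlarge⟩)
  exact ⟨lam, hlam, θ lam, hθ lam, hval⟩

theorem exists_even_periodic_isHillSolution_of_comparison (hcont : Continuous ρ)
    (hρ_pos : ∀ x, 0 < ρ x) (heven : ρ.Even) (hsymm : ∀ x, ρ (2 * A - x) = ρ x) (hsig : 0 < sig)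
    (hA : 0 < A) (hv : IsHillSolution k v w) (hw0 : w 0 = 0) (hvA : v A = 0)
    (hpos : ∀ x ∈ Set.Ioo 0 A, 0 < v x) (hk : ∀ x ∈ Set.Ioo 0 A, k x < sig * ρ x) :
    ∃ lam ∈ Set.Ioo 0 sig, ∃ u u' : ℝ → ℝ, u ≠ 0 ∧ IsHillSolution (fun x => lam * ρ x) u u' ∧
      u.Even ∧ u.Periodic (4 * A) := by
  obtain ⟨M, hM⟩ := ((periodic_two_mul_of_even heven hsymm).isBounded_of_continuous
    (by positivity) hcont).exists_norm_le
  have hρ (x : ℝ) : |ρ x| ≤ M.toNNReal :=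
    (hM _ (Set.mem_range_self x)).trans (Real.le_coe_toNNReal M)
  obtain ⟨lam, hlam, θ, hθ, hval⟩ :=
    exists_isPruferAngle_eq_pi_div_two hcont hρ hρ_pos hsig hA hv hw0 hvA hpos hk
  obtain ⟨R, hR, hu⟩ := hθ.exists_isHillSolution (by fun_prop)
  have hq (x : ℝ) : |lam * ρ x| ≤ (‖lam‖₊ * M.toNNReal : NNReal) := by
    rw [abs_mul]
    exact mul_le_mul_of_nonneg_left (hρ x) (abs_nonneg _)
  set u : ℝ → ℝ := fun x => R x * Real.cos (θ x) with hu_def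
  have hu_even : u.Even := hu.even hq (fun x => by rw [heven]) (by simp [hθ.1])
  have hu_refl := hu.neg_comp_two_mul_sub hq (A := A) (fun x => by rw [hsymm])
    (by simp [hu_def, hval])
  have hu_anti : u.Antiperiodic (2 * A) := fun x => by
    rw [← hu_refl, sub_add_cancel_right, hu_even]
  refine ⟨lam, hlam, u, _, fun hzero => (hR 0).ne' ?_, hu, hu_even, ?_⟩
  · simpa [hu_def, hθ.1] using congrFun hzero 0
  · rw [show 4 * A = 2 * (2 * A) by ring]
    exact hu_anti.periodic_two_mul

end Prufer

/-! ### The first eigenvalue -/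

theorem exists_isLeast_of_finite_inter_Iic {α : Type*} [LinearOrder α] {s : Set α} {b : α}
    (hb : b ∈ s) (hfin : (s ∩ Set.Iic b).Finite) : ∃ a ≤ b, IsLeast s a := by
  obtain ⟨a, ⟨has, hab⟩, hmin⟩ := Set.exists_min_image _ id hfin ⟨b, hb, le_rfl⟩
  refine ⟨a, hab, has, fun c hc => ?_⟩
  rcases le_total c b with hcb | hbc
  · exact hmin c ⟨hc, hcb⟩
  · exact hab.trans hbc

theorem pderiv_zero_comp_fst {u w : ℝ → ℝ} (hu : ∀ x, HasDerivAt u (w x) x) :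
    pderiv 0 (fun q => u q.1) = fun q => w q.1 := funext fun q =>
  (hasDerivAt_fst ((hu q.1).differentiableAt.comp q differentiableAt_fst)).unique (hu q.1)

theorem pderiv_one_comp_fst {u : ℝ → ℝ} (hu : Differentiable ℝ u) :
    pderiv 1 (fun q => u q.1) = 0 := funext fun q =>
  (hasDerivAt_snd ((hu q.1).comp q differentiableAt_fst)).unique
    (hasDerivAt_const q.2 (u q.1))

theorem isHillSolution_jacobiCn {p : ℝ} (hp : |p| < 1) (r : ℝ) :
    IsHillSolution (fun x => r ^ 2 * (1 - 2 * p ^ 2 * jacobiSn p (r * x) ^ 2))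
      (fun x => jacobiCn p (r * x)) fun x => -jacobiSn p (r * x) * jacobiDn p (r * x) * r := by
  have hmul (x : ℝ) : HasDerivAt (fun x => r * x) r x := by
    simpa using (hasDerivAt_id x).const_mul r
  refine ⟨fun x => (hasDerivAt_jacobiCn hp (r * x)).comp x (hmul x), fun x => ?_⟩
  have hsn := (hasDerivAt_jacobiSn hp (r * x)).comp x (hmul x)
  have hdn := (hasDerivAt_jacobiDn hp (r * x)).comp x (hmul x)
  refine ((hsn.neg.mul hdn).mul_const r).congr_deriv ?_
  simp only [Pi.neg_apply, Function.comp_apply]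
  linear_combination (-(r ^ 2 * jacobiCn p (r * x))) * jacobiDn_sq hp (r * x)

section FirstEigenvalue

variable {n m : ℤ}

theorem potential_jacobiCn_lt (hm : 0 < m) (hmn : m < n) (x : ℝ) :
    paramR n m ^ 2 * (1 - 2 * modulus n m ^ 2 * jacobiSn (modulus n m) (paramR n m * x) ^ 2) <
      (2 - (m : ℝ) ^ 2 / (n * (n + m))) * conformalFactor n m x := by
  have hn : 0 < n := hm.trans hmn
  have hr := paramR_pos hm hn
  have hp := modulus_pos hm hmn
  have hsub : (2 - (m : ℝ) ^ 2 / (n * (n + m))) * conformalFactor n m x - paramR n m ^ 2 *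
      (1 - 2 * modulus n m ^ 2 * jacobiSn (modulus n m) (paramR n m * x) ^ 2) =
      paramR n m ^ 2 * modulus n m ^ 2 * (1 + (m : ℝ) ^ 2 / (n * (n + m)) *
        jacobiSn (modulus n m) (paramR n m * x) ^ 2) := by
    rw [conformalFactor, modulus_sq hm hmn.le]
    field_simp
    ring
  rw [← sub_pos, hsub]
  positivity

theorem exists_kleinPositiveEigenvalue_lt (hm : 0 < m) (hmn : m < n) :
    ∃ lam ∈ kleinPositiveEigenvalues n m, lam < 2 - (m : ℝ) ^ 2 / (n * (n + m)) := by
  have hn : 0 < n := hm.trans hmn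
  have hp := abs_modulus_lt_one hm hmn.le
  have hr := paramR_pos hm hn
  have hrA := paramR_mul_quarterPeriod hm hn
  have hρ := contDiff_conformalFactor hm hmn.le
  have hsig : 0 < 2 - (m : ℝ) ^ 2 / (n * (n + m)) := by
    have hm' : 0 < (m : ℝ) := mod_cast hm
    have hmn' : (m : ℝ) < n := mod_cast hmn
    rw [sub_pos, div_lt_iff₀ (by positivity)]
    nlinarith
  obtain ⟨lam, hlam, u, w, hu0, hu, hu_even, hu_per⟩ :=
    exists_even_periodic_isHillSolution_of_comparison hρ.continuous
      (conformalFactor_pos hm hmn.le) (conformalFactor_even hm hmn.le)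
      (conformalFactor_two_mul_sub hm hmn.le) hsig (quarterPeriod_pos hm hmn.le)
      (isHillSolution_jacobiCn hp (paramR n m)) (by simp [jacobiSn_zero hp])
      (by rw [hrA, jacobiCn_ellipticK hp])
      (fun x hx => jacobiCn_pos_of_mem_Ico hp
        ⟨(mul_pos hr hx.1).le, (mul_lt_mul_of_pos_left hx.2 hr).trans_eq hrA⟩)
      (fun x _ => potential_jacobiCn_lt hm hmn x)
  refine ⟨lam, (mem_kleinPositiveEigenvalues hm hmn.le).2 ⟨hlam.1, fun q => u q.1, fun h => hu0 ?_,
    (hu.contDiff (contDiff_const.mul hρ)).comp contDiff_fst, fun x _ => hu_per x,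
    fun x _ => hu_even x, fun q => ?_⟩, hlam.2⟩
  · exact funext fun x => congrFun h (x, 0)
  · have hzero : pderiv 1 (0 : ℝ × ℝ → ℝ) = 0 :=
      pderiv_one_comp_fst (u := 0) (differentiable_const 0)
    rw [pderiv_zero_comp_fst hu.1, pderiv_zero_comp_fst hu.2,
      pderiv_one_comp_fst fun x => (hu.1 x).differentiableAt, hzero, Pi.zero_apply]
    ring

theorem finite_kleinPositiveEigenvalues_inter_Iic (hm : 0 < m) (hmn : m ≤ n) (Lam : ℝ) :
    (kleinPositiveEigenvalues n m ∩ Set.Iic Lam).Finite := by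
  have hA := quarterPeriod_pos hm hmn
  have hc := glideLength_pos hm (hm.trans_le hmn)
  have hcont := (contDiff_conformalFactor hm hmn).continuous
  refine (finite_torus_eigenvalues_le (ρ := fun q => conformalFactor n m q.1)
    (L := 4 * quarterPeriod n m) (H := 2 * glideLength n m) (by positivity) (by positivity)
    (by fun_prop) (fun q => conformalFactor_pos hm hmn q.1) Lam).subset ?_
  rintro lam ⟨hlam, hle⟩
  obtain ⟨-, F, hF0, hF, htrans, hglide, heq⟩ := (mem_kleinPositiveEigenvalues hm hmn).1 hlam
  refine ⟨hle, F, hF0, hF, fun ⟨x, y⟩ => by simpa using htrans x y, fun ⟨x, y⟩ => ?_, heq⟩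
  have htwice := hglide (-x) (y + glideLength n m)
  rw [hglide x y, neg_neg, add_assoc, ← two_mul] at htwice
  simpa using htwice

end FirstEigenvalue

end KleinCP2

theorem proposition5p3_general (n m : ℤ) (hm : 0 < m) (hmn : m < n) :
    (∃ lam₁ : ℝ, IsLeast (KleinCP2.kleinPositiveEigenvalues n m) lam₁ ∧
      lam₁ < 2 - 1 / (2 * KleinCP2.paramB n m ^ 3) ∧
      2 - 1 / (2 * KleinCP2.paramB n m ^ 3) = 2 - (m : ℝ) ^ 2 / (n * (n + m))) ∧
    KleinCP2.kleinArea n m = ENNReal.ofReal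
      (4 * Real.pi * √(n : ℝ) / (3 * √((n : ℝ) + 2 * m)) *
        (((n : ℝ) + 2 * m) * KleinCP2.ellipticE (KleinCP2.modulus n m) -
          m * KleinCP2.ellipticK (KleinCP2.modulus n m))) := by
  refine ⟨?_, KleinCP2.kleinArea_eq hm hmn.le⟩
  rw [KleinCP2.one_div_two_mul_paramB_cube hm (hm.trans hmn)]
  obtain ⟨lam, hlam, hlt⟩ := KleinCP2.exists_kleinPositiveEigenvalue_lt hm hmn
  obtain ⟨lam₁, hle, hleast⟩ := KleinCP2.exists_isLeast_of_finite_inter_Iic hlam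
    (KleinCP2.finite_kleinPositiveEigenvalues_inter_Iic hm hmn.le lam)
  exact ⟨lam₁, hleast, hle.trans_lt hlt, rfl⟩

theorem proposition5p3 (n m : ℤ) (hm : 0 < m) (hmn : m < n) (hcop : IsCoprime n m)
    (hodd : Odd n) (hdvd : 6 ∣ 2 * n + m) :
    (∃ lam₁ : ℝ, IsLeast (KleinCP2.kleinPositiveEigenvalues n m) lam₁ ∧
      lam₁ < 2 - 1 / (2 * KleinCP2.paramB n m ^ 3) ∧
      2 - 1 / (2 * KleinCP2.paramB n m ^ 3) = 2 - (m : ℝ) ^ 2 / (n * (n + m))) ∧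
    KleinCP2.kleinArea n m = ENNReal.ofReal
      (4 * Real.pi * √(n : ℝ) / (3 * √((n : ℝ) + 2 * m)) *
        (((n : ℝ) + 2 * m) * KleinCP2.ellipticE (KleinCP2.modulus n m) -
          m * KleinCP2.ellipticK (KleinCP2.modulus n m))) :=
  proposition5p3_general n m hm hmn
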